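/- **Setting.** Fix a countably infinite set of qubit names and a countably infinite, disjoint set of dangling names. A *domain* $d$ is a finite set of (qubit or dangling) names, with $\mathcal H_d=\bigotimes_{x\in d}\mathbb C^2$. A *quantum heap* is a density operator $\rho$ (positive, trace one) on $\mathcal H_d$ for some domain $d=\operatorname{dom}\rho$; $\rho|_a$ denotes its partial trace onto $a\subseteq d$. **Programs.** $$S::=\mathtt{skip}\mid \mathtt{qalloc}(q)\mid\mathtt{qfree}(q)\mid[\bar q]:=|0\rangle\mid U[\bar q]\mid S_1;S_2\mid \mathbf{if}\ \square m\cdot M_P[\bar q]\to S_m\ \mathbf{fi}\mid \mathbf{while}\ M_P[\bar q]\ \mathbf{do}\ S\ \mathbf{end},$$ with $\bar q$ a list of distinct qubit names, $U$ unitary, $M_P=\{P_m\}$ a finite projective measurement ($\sum_m P_m=I$), with two outcomes $0,1$ in a loop. The small-step semantics acts on pairs (program or $\downarrow$, heap), where $\downarrow$ is successful termination. Initialization maps $\rho$ to $\sum_i|0\rangle_{\bar q}\langle i|\rho|i\rangle_{\bar q}\langle 0|$, a unitary maps $\rho$ to $U\rho U^\dagger$, and a measurement passes to $P_m\rho P_m/\mathrm{tr}(P_m\rho)$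 and the corresponding continuation ($S_m$; or for a loop $\downarrow$ if $m=0$, the body followed by the loop if $m=1$) for any $m$ with $\mathrm{tr}(P_m\rho)\ne0$; all of these require $\bar q\subseteq\operatorname{dom}\rho$. $\mathtt{qfree}(q)$ requires $q\in\operatorname{dom}\rho$ and traces out $q$. $\mathtt{qalloc}(q)$ picks a dangling name $\sqcup\notin\operatorname{dom}\rho$, renames $q$ to $\sqcup$ (if $q$ is present), giving $\rho[q\Rightarrow\sqcup]$ on $d[q\Rightarrow\sqcup]$, and moves to any density operator $\rho'$ on $d[q\Rightarrow\sqcup]\cup\{q\}$ with $\rho'|_{d[q\Rightarrow\sqcup]}=\rho[q\Rightarrow\sqcup]$. An execution is *stuck* if it has not reached $\downarrow$ and no rule applies; $S$ is *safe* on $\rho$ if no execution from $(S,\rho)$ gets stuck; a domain $d$ is *stable* for $S$ if $S$ is safe on every heap with domain $d$. **Assertions.** For $s$ a finite set of qubit names and $P$ a subspace of $\mathcal H_{s}$, $$\psi::=\top\mid\bot\mid\top^*\mid s\mapsto P\mid\neg\psi\mid\psi\wedge\psi\mid\psi\vee\psi\mid\psi\rightsquigarrow\psi\mid\psi*\psi\mid\psi\mathrel{-\!*}\psi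 .$$ Each $\psi$ denotes, for every domain $d$, a subspace $[\![\psi]\!](d)\subseteq\mathcal H_d$: $\top,\bot$ denote $\mathcal H_d,0$; $\top^*$ denotes $\mathcal H_\emptyset$ if $d=\emptyset$, else $0$; $s\mapsto P$ denotes $P$ if $d=s$, else $0$; $\neg,\wedge,\vee$ are orthogonal complement, intersection and span; $A\rightsquigarrow B$ is $A^\perp\vee(A\wedge B)$; $[\![\psi*\varphi]\!](d)=\bigvee_{d'\subseteq d}[\![\psi]\!](d')\otimes[\![\varphi]\!](d\setminus d')$; and $[\![\psi\mathrel{-\!*}\varphi]\!](d)$ is the intersection, over all domains $d'$ disjoint from $d$, of the largest $R\subseteq\mathcal H_d$ with $[\![\psi]\!](d')\otimes R\subseteq[\![\varphi]\!](d'\cup d)$. Write $s\hookrightarrow P$ for $(s\mapsto P)*\top$. A heap $\rho$ satisfies $\psi$ if $\operatorname{supp}\rho\subseteq[\![\psi]\!](\operatorname{dom}\rho)$. The triple $\{\psi\}S\{\varphi\}$ is *valid* if for every heap $\rho$ satisfying $\psi$, $S$ is safe on $\rho$ and every heap in which $S$ can terminate from $\rho$ satisfies $\varphi$. **Correct usage.**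 A *quantum operation* is a completely positive, trace non-increasing superoperator. An *execution path* $\pi: d=d_0\xrightarrow{\pi_1}d_1\to\cdots\xrightarrow{\pi_n}d_n$ of $S$ from $d$ records the operations and domains along a terminating run of $S$ at the level of domains, where any measurement outcome may be chosen (probability $0$ included). Let $D\pi=\bigcup_i d_i$. Step $i$ is encoded by any superoperator of the form $\mathcal E_{D\pi\setminus d_{i-1}}\otimes\mathcal I_{d_{i-1}}$ if $d_{i-1}\subsetneq d_i$, and $\mathcal E_{D\pi\setminus d_i}\otimes\mathcal I_{d_i}$ if $d_i\subsetneq d_{i-1}$, where $\mathcal E$ is an arbitrary quantum operation; if $\pi_i$ is a basic operation $\mathcal E[\bar q]$ (identity, initialization, unitary, or $A\mapsto P_mAP_m$), it is encoded by $\mathcal E_{\bar q}\otimes\mathcal I_{D\pi\setminus\bar q}$. Let $\mathcal E\pi$ be the set of all composites, in order, of encodings of the steps. $S$ *correctly uses the dirty qubit* $q$ if for every stable domain $d$ of $S$ and every execution path $\pi$ of $S$ from $d$, either $q\notin D\pi$, or every $\mathcal E\in\mathcal E\pi$ equals $\mathcal E'_{D\pi\setminus\{q\}}\otimes\mathcal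 I_q$ for some quantum operation $\mathcal E'$. **Theorem (Main Theorem for Correct Usage of Dirty Qubits).** Let $S$ be a program and $q$ a qubit name such that $S$ contains neither $\mathtt{qalloc}(q)$ nor $\mathtt{qfree}(q)$. Let $|\Phi\rangle=\frac1{\sqrt2}(|00\rangle+|11\rangle)$, and suppose that for every assertion $\psi$ and every qubit name $q'\ne q$ appearing neither in $S$ nor in $\psi$, $$\{\psi\}\,S\,\{\top\}\text{ valid}\ \Longrightarrow\ \{\psi\wedge (q,q'\hookrightarrow|\Phi\rangle\langle\Phi|)\}\,S\,\{q,q'\hookrightarrow|\Phi\rangle\langle\Phi|\}\text{ valid}.$$ Then $S$ correctly uses the dirty qubit $q$. -/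

import Mathlib

open scoped ComplexOrder

noncomputable section

namespace QSL

/-! ### Qubits, states and superoperators -/

/-- Qubit names. -/
abbrev QName := ℕ

/-- Elements of quantum domains: `Sum.inl q` is the qubit name `q`, `Sum.inr s` is the dangling
name with index `s`. -/
abbrev QDomain := ℕ ⊕ ℕ

/-- The domain made of a finite set of qubit names. -/
def nameDom (s : Finset QName) : Finset QDomain := s.map Function.Embedding.inl

/-- The state space of qubits indexed by `ι`, with computational basis `ι → Fin 2`. -/
abbrev Ket (ι : Type) [Fintype ι] [DecidableEq ι] := EuclideanSpace ℂ (ι → Fin 2)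

/-- Operators on the state space of qubits indexed by `ι`, as matrices in the computational
basis. -/
abbrev Op (ι : Type) := Matrix (ι → Fin 2) (ι → Fin 2) ℂ

/-- Superoperators on qubits indexed by `ι`. -/
abbrev SuperOp (ι : Type) := Op ι →ₗ[ℂ] Op ι

/-- Inclusion of domains. -/
def incl {a d : Finset QDomain} (h : a ⊆ d) : a ↪ d :=
  ⟨fun i => ⟨i.1, h i.2⟩, fun _ _ hij => Subtype.ext (congrArg (fun t : d => t.1) hij)⟩

/-- The position, in the domain `d`, of an ordered list `v` of distinct qubit names that all
belong to `d`. -/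
def place {n : ℕ} (v : Fin n ↪ QName) {d : Finset QDomain} (h : ∀ i, Sum.inl (v i) ∈ d) :
    Fin n ↪ d :=
  ⟨fun i => ⟨Sum.inl (v i), h i⟩, fun _ _ hij =>
    v.injective (Sum.inl_injective (congrArg (fun t : d => t.1) hij))⟩

/-- `liftOp e E` is `E ⊗ I`, where `E` acts on the qubits `e i` and the identity superoperator
acts on all other qubits.  The matrix `A` is split into blocks labelled by the values of `x` and
`y` outside the range of `e`, and `E` is applied to each block. -/
def liftOp {ι κ : Type} (e : ι ↪ κ) (E : SuperOp ι) : SuperOp κ where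
  toFun A := Matrix.of fun x y =>
    E (Matrix.of fun u v => A (Function.extend e u x) (Function.extend e v y)) (x ∘ e) (y ∘ e)
  map_add' A B := by
    ext x y
    exact congrFun (congrFun (E.map_add
      (Matrix.of fun u v => A (Function.extend e u x) (Function.extend e v y))
      (Matrix.of fun u v => B (Function.extend e u x) (Function.extend e v y))) (x ∘ e)) (y ∘ e)
  map_smul' c A := by
    ext x y
    exact congrFun (congrFun (E.map_smul c
      (Matrix.of fun u v => A (Function.extend e u x) (Function.extend e v y))) (x ∘ e)) (y ∘ e)

/-- Complete positivity: `E ⊗ I_k` preserves positive semidefiniteness for every ancilla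
dimension `k`. -/
def IsCompletelyPositive {ι : Type} (E : SuperOp ι) : Prop :=
  ∀ (k : ℕ) (A : Matrix ((ι → Fin 2) × Fin k) ((ι → Fin 2) × Fin k) ℂ), A.PosSemidef →
    (Matrix.of fun x y : (ι → Fin 2) × Fin k =>
      E (Matrix.of fun u v => A (u, x.2) (v, y.2)) x.1 y.1).PosSemidef

/-- Quantum operations: completely positive, trace non-increasing superoperators. -/
def IsQuantumOp {ι : Type} [Fintype ι] [DecidableEq ι] (E : SuperOp ι) : Prop :=
  IsCompletelyPositive E ∧ ∀ A : Op ι, A.PosSemidef → (E A).trace.re ≤ A.trace.re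

/-- The superoperator `A ↦ K A K†`. -/
def conjOp {ι : Type} [Fintype ι] [DecidableEq ι] (K : Op ι) : SuperOp ι where
  toFun A := K * A * K.conjTranspose
  map_add' A B := by simp [Matrix.mul_add, Matrix.add_mul]
  map_smul' c A := by simp

/-- Initialization `A ↦ ∑ i, |0⟩⟨i| A |i⟩⟨0|`. -/
def initOp (n : ℕ) : SuperOp (Fin n) :=
  ∑ b : Fin n → Fin 2, conjOp (Matrix.single (fun _ => 0) b 1)

/-! ### Quantum heaps -/

/-- Density operators on the qubits in `d`. -/
abbrev Density (d : Finset QDomain) : Type :=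
  {A : Op d // A.PosSemidef ∧ A.trace = 1}

/-- Quantum heaps: density operators with a finite domain. -/
abbrev QHeap := Σ d : Finset QDomain, Density d

/-- Joins a basis label on `a` and one on `d \ a` to a basis label on `d`. -/
def glue {a d : Finset QDomain} (x : a → Fin 2) (z : ↥(d \ a) → Fin 2) : d → Fin 2 :=
  fun i => if hi : i.1 ∈ a then x ⟨i.1, hi⟩ else z ⟨i.1, Finset.mem_sdiff.2 ⟨i.2, hi⟩⟩

/-- The restriction `A|_a` to a subdomain `a ⊆ d`: the partial trace over `d \ a`. -/
def restrict {d : Finset QDomain} (A : Op d) (a : Finset QDomain) : Op a :=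
  Matrix.of fun x y => ∑ z : ↥(d \ a) → Fin 2, A (glue x z) (glue y z)

/-- The domain `d[q ⇒ s]`, with the qubit name `q` replaced by the dangling name `s`.  It is only
used for `s` outside `d`, and it is `d` itself when `q` is not in `d` either. -/
def renameDom (q : QName) (s : ℕ) (d : Finset QDomain) : Finset QDomain :=
  d.map (Equiv.swap (Sum.inl q) (Sum.inr s)).toEmbedding

/-- The operator `A[q ⇒ s]`: the same matrix with its subscripts renamed. -/
def rename (q : QName) (s : ℕ) {d : Finset QDomain} (A : Op d) : Op (renameDom q s d) :=
  Matrix.of fun x y =>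
    A (fun i => x ⟨Equiv.swap (Sum.inl q) (Sum.inr s) i.1, Finset.mem_map_of_mem _ i.2⟩)
      (fun i => y ⟨Equiv.swap (Sum.inl q) (Sum.inr s) i.1, Finset.mem_map_of_mem _ i.2⟩)

/-- The support of a positive operator: the orthogonal complement of its kernel. -/
def supp {ι : Type} [Fintype ι] [DecidableEq ι] (A : Op ι) : Submodule ℂ (Ket ι) :=
  (LinearMap.ker (Matrix.toEuclideanLin A))ᗮ

/-! ### Assertions

Projections are identified with subspaces. -/

/-- `v ⊗ w` as a vector over the domain `d = d₁ ⊔ d₂`. -/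
def tensorKet {d₁ d₂ d : Finset QDomain} (h₁ : d₁ ⊆ d) (h₂ : d₂ ⊆ d) (v : Ket d₁) (w : Ket d₂) :
    Ket d :=
  WithLp.toLp 2 fun x => v (x ∘ incl h₁) * w (x ∘ incl h₂)

/-- `P ⊗ Q` as a subspace over the domain `d = d₁ ⊔ d₂`. -/
def tensor {d₁ d₂ d : Finset QDomain} (h₁ : d₁ ⊆ d) (h₂ : d₂ ⊆ d)
    (P : Submodule ℂ (Ket d₁)) (Q : Submodule ℂ (Ket d₂)) : Submodule ℂ (Ket d) :=
  Submodule.span ℂ {u | ∃ v ∈ P, ∃ w ∈ Q, u = tensorKet h₁ h₂ v w}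

/-- Tensor implication: the largest `R` with `P ⊗ R ⊆ Q`. -/
def tensorImp {d₁ d₂ d : Finset QDomain} (h₁ : d₁ ⊆ d) (h₂ : d₂ ⊆ d)
    (P : Submodule ℂ (Ket d₁)) (Q : Submodule ℂ (Ket d)) : Submodule ℂ (Ket d₂) :=
  sSup {R | tensor h₁ h₂ P R ≤ Q}

/-- Formulas of the quantum BI-style logic. -/
inductive Assr : Type
  | top : Assr
  | bot : Assr
  | emp : Assr
  | pointsTo (s : Finset QName) (P : Submodule ℂ (Ket (nameDom s))) : Assr
  | neg (ψ : Assr) : Assr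
  | and (ψ φ : Assr) : Assr
  | or (ψ φ : Assr) : Assr
  | hook (ψ φ : Assr) : Assr
  | sep (ψ φ : Assr) : Assr
  | wand (ψ φ : Assr) : Assr

namespace Assr

/-- The domain-dependent semantics of assertions. -/
def sem : Assr → (d : Finset QDomain) → Submodule ℂ (Ket d)
  | top, _ => ⊤
  | bot, _ => ⊥
  | emp, d => if d = ∅ then ⊤ else ⊥
  | pointsTo s P, d => if h : nameDom s = d then h ▸ P else ⊥
  | neg ψ, d => (ψ.sem d)ᗮ
  | and ψ φ, d => ψ.sem d ⊓ φ.sem d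
  | or ψ φ, d => ψ.sem d ⊔ φ.sem d
  | hook ψ φ, d => (ψ.sem d)ᗮ ⊔ (ψ.sem d ⊓ φ.sem d)
  | sep ψ φ, d => ⨆ (d' : Finset QDomain) (h : d' ⊆ d),
      tensor h Finset.sdiff_subset (ψ.sem d') (φ.sem (d \ d'))
  | wand ψ φ, d => ⨅ (d' : Finset QDomain) (_ : Disjoint d' d),
      tensorImp Finset.subset_union_left Finset.subset_union_right (ψ.sem d') (φ.sem (d' ∪ d))

/-- The qubit names that appear in an assertion. -/
def qbit : Assr → Set QName
  | top => ∅
  | bot => ∅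
  | emp => ∅
  | pointsTo s _ => ↑s
  | neg ψ => ψ.qbit
  | and ψ φ => ψ.qbit ∪ φ.qbit
  | or ψ φ => ψ.qbit ∪ φ.qbit
  | hook ψ φ => ψ.qbit ∪ φ.qbit
  | sep ψ φ => ψ.qbit ∪ φ.qbit
  | wand ψ φ => ψ.qbit ∪ φ.qbit

/-- The assertion `s ↪ P`, that is, `(s ↦ P) * ⊤`. -/
def contains (s : Finset QName) (P : Submodule ℂ (Ket (nameDom s))) : Assr :=
  sep (pointsTo s P) top

end Assr

/-- Satisfaction of an assertion by a quantum heap. -/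
def Sat (ρ : QHeap) (ψ : Assr) : Prop := supp ρ.2.1 ≤ ψ.sem ρ.1

/-- The vector `|Φ⟩ = (|00⟩ + |11⟩) / √2` on the qubits `q`, `q'`. -/
def bellKet (q q' : QName) : Ket (nameDom {q, q'}) :=
  WithLp.toLp 2 fun x =>
    if x ⟨Sum.inl q, by simp [nameDom]⟩ = x ⟨Sum.inl q', by simp [nameDom]⟩
    then ((1 / √2 : ℝ) : ℂ) else 0

/-- The assertion `q, q' ↪ |Φ⟩⟨Φ|`. -/
def bellAssr (q q' : QName) : Assr :=
  Assr.contains {q, q'} (Submodule.span ℂ {bellKet q q'})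

/-! ### Programs -/

/-- A projective measurement of `n` qubits with `k` outcomes. -/
structure Measurement (n k : ℕ) where
  P : Fin k → Op (Fin n)
  isProj : ∀ m, IsStarProjection (P m)
  sum_eq_one : ∑ m, P m = 1

/-- Program statements. -/
inductive Stmt : Type
  | skip : Stmt
  | qalloc (q : QName) : Stmt
  | qfree (q : QName) : Stmt
  | init {n : ℕ} (v : Fin n ↪ QName) : Stmt
  | unitary {n : ℕ} (v : Fin n ↪ QName) (U : Matrix.unitaryGroup (Fin n → Fin 2) ℂ) : Stmt
  | seq (S₁ S₂ : Stmt) : Stmt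
  | ifm {n k : ℕ} (v : Fin n ↪ QName) (M : Measurement n k) (S : Fin k → Stmt) : Stmt
  | while {n : ℕ} (v : Fin n ↪ QName) (M : Measurement n 2) (S : Stmt) : Stmt

namespace Stmt

/-- The qubit names that appear in a program. -/
def qbit : Stmt → Set QName
  | skip => ∅
  | qalloc q => {q}
  | qfree q => {q}
  | init v => Set.range v
  | unitary v _ => Set.range v
  | seq S₁ S₂ => S₁.qbit ∪ S₂.qbit
  | ifm v _ S => Set.range v ∪ ⋃ m, (S m).qbit
  | .while v _ S => Set.range v ∪ S.qbit

/-- The qubit names that are allocated in a program. -/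
def allocated : Stmt → Set QName
  | skip => ∅
  | qalloc q => {q}
  | qfree _ => ∅
  | init _ => ∅
  | unitary _ _ => ∅
  | seq S₁ S₂ => S₁.allocated ∪ S₂.allocated
  | ifm _ _ S => ⋃ m, (S m).allocated
  | .while _ _ S => S.allocated

/-- The qubit names that are freed in a program. -/
def freed : Stmt → Set QName
  | skip => ∅
  | qalloc _ => ∅
  | qfree q => {q}
  | init _ => ∅
  | unitary _ _ => ∅
  | seq S₁ S₂ => S₁.freed ∪ S₂.freed
  | ifm _ _ S => ⋃ m, (S m).freed
  | .while _ _ S => S.freed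

end Stmt

/-- Configurations; `none` stands for successful termination. -/
abbrev Config := Option Stmt × QHeap

/-- Small-step operational semantics.  The probability `tr (P ρ)` of an outcome with projection
`P` is written in the equivalent form `tr (P ρ P)`. -/
inductive Step : Config → Config → Prop
  | skip (ρ : QHeap) : Step (some .skip, ρ) (none, ρ)
  | init {n : ℕ} {v : Fin n ↪ QName} {d : Finset QDomain} (h : ∀ i, Sum.inl (v i) ∈ d)
      (ρ ρ' : Density d) (hρ : ρ'.1 = liftOp (place v h) (initOp n) ρ.1) :
      Step (some (.init v), ⟨d, ρ⟩) (none, ⟨d, ρ'⟩)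
  | unitary {n : ℕ} {v : Fin n ↪ QName} {U : Matrix.unitaryGroup (Fin n → Fin 2) ℂ}
      {d : Finset QDomain} (h : ∀ i, Sum.inl (v i) ∈ d)
      (ρ ρ' : Density d) (hρ : ρ'.1 = liftOp (place v h) (conjOp U.1) ρ.1) :
      Step (some (.unitary v U), ⟨d, ρ⟩) (none, ⟨d, ρ'⟩)
  | qalloc {q : QName} {d : Finset QDomain} (ρ : Density d) (s : ℕ) (hs : Sum.inr s ∉ d)
      (ρ' : Density (insert (Sum.inl q) (renameDom q s d)))
      (hρ : restrict ρ'.1 (renameDom q s d) = rename q s ρ.1) :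
      Step (some (.qalloc q), ⟨d, ρ⟩) (none, ⟨insert (Sum.inl q) (renameDom q s d), ρ'⟩)
  | qfree {q : QName} {d : Finset QDomain} (h : Sum.inl q ∈ d) (ρ : Density d)
      (ρ' : Density (d \ {Sum.inl q})) (hρ : ρ'.1 = restrict ρ.1 (d \ {Sum.inl q})) :
      Step (some (.qfree q), ⟨d, ρ⟩) (none, ⟨d \ {Sum.inl q}, ρ'⟩)
  | seq_step {S₁ S₁' S₂ : Stmt} {ρ ρ' : QHeap} (h : Step (some S₁, ρ) (some S₁', ρ')) :
      Step (some (.seq S₁ S₂), ρ) (some (.seq S₁' S₂), ρ')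
  | seq_done {S₁ S₂ : Stmt} {ρ ρ' : QHeap} (h : Step (some S₁, ρ) (none, ρ')) :
      Step (some (.seq S₁ S₂), ρ) (some S₂, ρ')
  | ifm {n k : ℕ} {v : Fin n ↪ QName} {M : Measurement n k} {S : Fin k → Stmt}
      {d : Finset QDomain} (h : ∀ i, Sum.inl (v i) ∈ d) (m : Fin k) (ρ ρ' : Density d)
      (hm : (liftOp (place v h) (conjOp (M.P m)) ρ.1).trace ≠ 0)
      (hρ : ρ'.1 = (liftOp (place v h) (conjOp (M.P m)) ρ.1).trace⁻¹ •
        liftOp (place v h) (conjOp (M.P m)) ρ.1) :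
      Step (some (.ifm v M S), ⟨d, ρ⟩) (some (S m), ⟨d, ρ'⟩)
  | while_done {n : ℕ} {v : Fin n ↪ QName} {M : Measurement n 2} {S : Stmt}
      {d : Finset QDomain} (h : ∀ i, Sum.inl (v i) ∈ d) (ρ ρ' : Density d)
      (hm : (liftOp (place v h) (conjOp (M.P 0)) ρ.1).trace ≠ 0)
      (hρ : ρ'.1 = (liftOp (place v h) (conjOp (M.P 0)) ρ.1).trace⁻¹ •
        liftOp (place v h) (conjOp (M.P 0)) ρ.1) :
      Step (some (.while v M S), ⟨d, ρ⟩) (none, ⟨d, ρ'⟩)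
  | while_loop {n : ℕ} {v : Fin n ↪ QName} {M : Measurement n 2} {S : Stmt}
      {d : Finset QDomain} (h : ∀ i, Sum.inl (v i) ∈ d) (ρ ρ' : Density d)
      (hm : (liftOp (place v h) (conjOp (M.P 1)) ρ.1).trace ≠ 0)
      (hρ : ρ'.1 = (liftOp (place v h) (conjOp (M.P 1)) ρ.1).trace⁻¹ •
        liftOp (place v h) (conjOp (M.P 1)) ρ.1) :
      Step (some (.while v M S), ⟨d, ρ⟩) (some (.seq S (.while v M S)), ⟨d, ρ'⟩)

/-- The execution of `S` on `ρ` does not get stuck. -/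
def Safe (S : Stmt) (ρ : QHeap) : Prop :=
  ∀ (S' : Stmt) (ρ' : QHeap), Relation.ReflTransGen Step (some S, ρ) (some S', ρ') →
    ∃ c : Config, Step (some S', ρ') c

/-- Validity of the correctness triple `{ψ} S {φ}`. -/
def Valid (ψ : Assr) (S : Stmt) (φ : Assr) : Prop :=
  ∀ ρ : QHeap, Sat ρ ψ →
    Safe S ρ ∧ ∀ ρ' : QHeap, Relation.ReflTransGen Step (some S, ρ) (none, ρ') → Sat ρ' φ

/-- `S` is stable in the domain `d`: it gets stuck on no quantum heap with domain `d`. -/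
def Stable (S : Stmt) (d : Finset QDomain) : Prop :=
  ∀ ρ : Density d, Safe S ⟨d, ρ⟩

/-! ### Execution paths and their encoding -/

/-- The operation applied at one step of an execution path. -/
inductive PathOp : Type
  | basic {n : ℕ} (v : Fin n ↪ QName) (E : SuperOp (Fin n)) : PathOp
  | alloc (q : QName) : PathOp
  | free (q : QName) : PathOp

/-- `PathStep S d o S' d'`: one step of `S` with current domain `d` applies the operation `o`,
and leaves the program `S'` and the domain `d'`.  Every measurement outcome may be chosen. -/
inductive PathStep : Stmt → Finset QDomain → PathOp → Option Stmt → Finset QDomain → Prop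
  | skip (d : Finset QDomain) :
      PathStep .skip d (.basic (n := 0) Function.Embedding.ofIsEmpty LinearMap.id) none d
  | init {n : ℕ} {v : Fin n ↪ QName} {d : Finset QDomain} (h : ∀ i, Sum.inl (v i) ∈ d) :
      PathStep (.init v) d (.basic v (initOp n)) none d
  | unitary {n : ℕ} {v : Fin n ↪ QName} {U : Matrix.unitaryGroup (Fin n → Fin 2) ℂ}
      {d : Finset QDomain} (h : ∀ i, Sum.inl (v i) ∈ d) :
      PathStep (.unitary v U) d (.basic v (conjOp U.1)) none d
  | qalloc {q : QName} {d : Finset QDomain} (s : ℕ) (hs : Sum.inr s ∉ d) :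
      PathStep (.qalloc q) d (.alloc q) none (insert (Sum.inl q) (renameDom q s d))
  | qfree {q : QName} {d : Finset QDomain} (h : Sum.inl q ∈ d) :
      PathStep (.qfree q) d (.free q) none (d \ {Sum.inl q})
  | seq_step {S₁ S₁' S₂ : Stmt} {d d' : Finset QDomain} {o : PathOp}
      (h : PathStep S₁ d o (some S₁') d') :
      PathStep (.seq S₁ S₂) d o (some (.seq S₁' S₂)) d'
  | seq_done {S₁ S₂ : Stmt} {d d' : Finset QDomain} {o : PathOp}
      (h : PathStep S₁ d o none d') :
      PathStep (.seq S₁ S₂) d o (some S₂) d'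
  | ifm {n k : ℕ} {v : Fin n ↪ QName} {M : Measurement n k} {S : Fin k → Stmt}
      {d : Finset QDomain} (h : ∀ i, Sum.inl (v i) ∈ d) (m : Fin k) :
      PathStep (.ifm v M S) d (.basic v (conjOp (M.P m))) (some (S m)) d
  | while_done {n : ℕ} {v : Fin n ↪ QName} {M : Measurement n 2} {S : Stmt}
      {d : Finset QDomain} (h : ∀ i, Sum.inl (v i) ∈ d) :
      PathStep (.while v M S) d (.basic v (conjOp (M.P 0))) none d
  | while_loop {n : ℕ} {v : Fin n ↪ QName} {M : Measurement n 2} {S : Stmt}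
      {d : Finset QDomain} (h : ∀ i, Sum.inl (v i) ∈ d) :
      PathStep (.while v M S) d (.basic v (conjOp (M.P 1))) (some (.seq S (.while v M S))) d

/-- `IsPath S d π`: the list `π` of pairs `(πᵢ, dᵢ)` is an execution path
`d → d₁ → ⋯ → dₙ` of `S` from the domain `d` until normal termination. -/
inductive IsPath : Option Stmt → Finset QDomain → List (PathOp × Finset QDomain) → Prop
  | nil (d : Finset QDomain) : IsPath none d []
  | cons {S : Stmt} {S' : Option Stmt} {d d' : Finset QDomain} {o : PathOp}
      {π : List (PathOp × Finset QDomain)} (h : PathStep S d o S' d') (hπ : IsPath S' d' π) :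
      IsPath (some S) d ((o, d') :: π)

/-- The union `Dπ` of all domains encountered along a path. -/
def pathDom (d : Finset QDomain) : List (PathOp × Finset QDomain) → Finset QDomain
  | [] => d
  | p :: π => d ∪ pathDom p.2 π

/-- `EncodesStep D d o d' F`: over the global domain `D`, the quantum operation `F` encodes the
step `d → d'` with operation `o`. -/
inductive EncodesStep (D : Finset QDomain) :
    Finset QDomain → PathOp → Finset QDomain → SuperOp D → Prop
  | grow {d d' : Finset QDomain} {o : PathOp} (h : d ⊂ d') (E : SuperOp ↥(D \ d))
      (hE : IsQuantumOp E) :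
      EncodesStep D d o d' (liftOp (incl Finset.sdiff_subset) E)
  | shrink {d d' : Finset QDomain} {o : PathOp} (h : d' ⊂ d) (E : SuperOp ↥(D \ d'))
      (hE : IsQuantumOp E) :
      EncodesStep D d o d' (liftOp (incl Finset.sdiff_subset) E)
  | basic {d : Finset QDomain} {n : ℕ} {v : Fin n ↪ QName} {E : SuperOp (Fin n)}
      (h : ∀ i, Sum.inl (v i) ∈ D) :
      EncodesStep D d (.basic v E) d (liftOp (place v h) E)

/-- `Encodes D d π E`: the superoperator `E` belongs to the set of quantum operations over the
global domain `D` that encode the path `π` from the domain `d`. -/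
inductive Encodes (D : Finset QDomain) :
    Finset QDomain → List (PathOp × Finset QDomain) → SuperOp D → Prop
  | nil (d : Finset QDomain) : Encodes D d [] LinearMap.id
  | cons {d d' : Finset QDomain} {o : PathOp} {π : List (PathOp × Finset QDomain)}
      {F G : SuperOp D} (hF : EncodesStep D d o d' F) (hG : Encodes D d' π G) :
      Encodes D d ((o, d') :: π) (G ∘ₗ F)

/-- `S` correctly uses the dirty qubit `q`. -/
def CorrectlyUses (S : Stmt) (q : QName) : Prop :=
  ∀ (d : Finset QDomain) (π : List (PathOp × Finset QDomain)),
    Stable S d → IsPath (some S) d π →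
      Sum.inl q ∉ pathDom d π ∨
      ∀ E : SuperOp (pathDom d π), Encodes (pathDom d π) d π E →
        ∃ E' : SuperOp ↥(pathDom d π \ {Sum.inl q}),
          IsQuantumOp E' ∧ E = liftOp (incl Finset.sdiff_subset) E'

end QSL

end

/-!
The proof tracks operators along an execution path instead of superoperators.  Every encoding of a
path is a linear combination of maps `A ↦ K A L†`, where `K` and `L` are products of Kraus
operators of the basic steps and of arbitrary operators outside the current domain
(`PathKraus`, `Encodes.mem_sandSpan`).  If each such `K` has the form `K' ⊗ I` with the identity on
`q`, then the encoding is `E' ⊗ I` (`exists_eq_liftOp`), and `E'` is a quantum operation because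
the encoding is one (`isQuantumOp_of_liftOp`).

To see that `K` acts as the identity on `q`, one lets `K` act on a Bell state of `q` and a fresh
qubit `q'`, tensored with an arbitrary basis state; by `exists_eq_liftMat` it is enough that the
result is again such a Bell state, times a vector, or zero.  By `exists_run`, the path is followed
by an actual run of the program from a heap in which `q` and `q'` form a Bell state and all else
is completely mixed, unless the operators of the path annihilate the vector; in this run every
newly allocated qubit is chosen completely mixed.  The invariant is that the image of the vector
is supported by the state of the *named* qubits of the current heap.  Tracing out the dangling
qubits in the invariant is what makes it stable under the allocation of a name `p` already in use:
the heap moves the old content of `p` to a dangling name, whereas the encoding keeps it in `p`.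
The final heap satisfies the Bell assertion by hypothesis, hence so does the image of the vector.

The hypothesis on triples is used with the assertion "all names of `d` are present".  Its triple
with postcondition `⊤` is valid (`Stable.valid`), since a run on any larger heap can be imitated
step by step from the completely mixed heap on `d`: supports of named parts remain included
(`Dominates.effect`), so no outcome with positive probability is lost.

States are handled as families of vectors (`Rep`), and vectors over all domains as functions of
labels of all names.  That the slices of a vector over a set of coordinates lie in the span of the
slices of a family is expressed by double annihilators (`Covers`), which avoids tensor products of
spaces over varying domains.
-/

open scoped ComplexOrder

noncomputable section

namespace QSL

/-! ### Functions of basis labels -/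

section Labels

variable {Q : Type}

/-- Overrides the label `x` on the finite set `n` by `u`. -/
abbrev patch {n : Finset Q} (u : n → Fin 2) (x : Q → Fin 2) : Q → Fin 2 :=
  Function.extend Subtype.val u x

theorem patch_mem {n : Finset Q} (u : n → Fin 2) (x : Q → Fin 2) {i : Q} (h : i ∈ n) :
    patch u x i = u ⟨i, h⟩ :=
  Subtype.val_injective.extend_apply u x ⟨i, h⟩

theorem patch_notMem {n : Finset Q} (u : n → Fin 2) (x : Q → Fin 2) {i : Q} (h : i ∉ n) :
    patch u x i = x i :=
  Function.extend_apply' _ _ _ fun ⟨a, ha⟩ => h (ha ▸ a.2)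

theorem patch_comp_val {n : Finset Q} (u : n → Fin 2) (x : Q → Fin 2) :
    (fun i : n => patch u x i) = u :=
  funext fun i => patch_mem u x i.2

variable [DecidableEq Q]

/-- The labels that agree with `x` outside `n`. -/
def box (n : Finset Q) (x : Q → Fin 2) : Finset (Q → Fin 2) :=
  Finset.univ.map ⟨fun u : n → Fin 2 => patch u x,
    Function.extend_injective Subtype.val_injective x⟩

theorem mem_box {n : Finset Q} {x y : Q → Fin 2} : y ∈ box n x ↔ ∀ i ∉ n, y i = x i := by
  simp only [box, Finset.mem_map, Finset.mem_univ, true_and, Function.Embedding.coeFn_mk]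
  constructor
  · rintro ⟨u, rfl⟩ i hi
    exact patch_notMem u x hi
  · intro h
    refine ⟨fun i => y i, funext fun i => ?_⟩
    by_cases hi : i ∈ n
    · rw [patch_mem _ _ hi]
    · rw [patch_notMem _ _ hi, h i hi]

theorem sum_box (n : Finset Q) (x : Q → Fin 2) (f : (Q → Fin 2) → ℂ) :
    ∑ y ∈ box n x, f y = ∑ u : n → Fin 2, f (patch u x) := by
  simp [box]

/-- Freezing the coordinates in `n \ m` turns a sum over `n` into a sum over `m`. -/
theorem sum_box_freeze {m n : Finset Q} (hmn : m ⊆ n) (x z : Q → Fin 2)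
    (f : (Q → Fin 2) → ℂ) :
    (∑ y ∈ box n x, if ∀ i ∈ n \ m, y i = z i then f y else 0) =
      ∑ y ∈ box m ((n \ m).piecewise z x), f y := by
  rw [← Finset.sum_filter]
  congr 1
  ext y
  simp only [Finset.mem_filter, mem_box, Finset.piecewise, Finset.mem_sdiff]
  grind

theorem sum_box_point (n : Finset Q) (x z : Q → Fin 2) (f : (Q → Fin 2) → ℂ) :
    (∑ y ∈ box n x, if ∀ i ∈ n, y i = z i then f y else 0) = f (n.piecewise z x) := by
  have h := sum_box_freeze (Finset.empty_subset n) x z f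
  rw [Finset.sdiff_empty] at h
  rw [h]
  have : box ∅ (n.piecewise z x) = {n.piecewise z x} := by
    ext y
    simp [mem_box, funext_iff]
  simp [this]

/-- Splitting a sum according to the value of one coordinate. -/
theorem sum_box_insert {m : Finset Q} {p : Q} (hp : p ∉ m) (x : Q → Fin 2)
    (f : (Q → Fin 2) → ℂ) :
    ∑ y ∈ box (insert p m) x, f y = ∑ b, ∑ y ∈ box m (Function.update x p b), f y := by
  rw [← Finset.sum_fiberwise (box (insert p m) x) (fun y => y p)]
  refine Finset.sum_congr rfl fun b _ => Finset.sum_congr ?_ fun _ _ => rfl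
  ext y
  simp only [Finset.mem_filter, mem_box, Finset.mem_insert, Function.update_apply]
  grind

/-- The bilinear pairing of `w` with each slice of `ξ` over the coordinates in `n` vanishes. -/
def Kills (n : Finset Q) (w ξ : (Q → Fin 2) → ℂ) : Prop :=
  ∀ x, ∑ y ∈ box n x, w y * ξ y = 0

/-- Every slice of `ξ` over the coordinates in `n` lies in the span of the slices of the family
`r`.  The span is encoded as a double annihilator: every linear functional `w` of the coordinates
in `n` that kills all slices of `r` kills all slices of `ξ`. -/
def Covers {J : Type} (n : Finset Q) (r : J → (Q → Fin 2) → ℂ) (ξ : (Q → Fin 2) → ℂ) : Prop :=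
  ∀ w : (Q → Fin 2) → ℂ, DependsOn w n → (∀ j, Kills n w (r j)) → Kills n w ξ

/-- The operator `K ⊗ I` on functions of labels, with `K` acting on the qubits `e i`. -/
def act {ι : Type} [Fintype ι] [DecidableEq ι] {κ : Type} (e : ι → κ) (K : Op ι)
    (f : (κ → Fin 2) → ℂ) : (κ → Fin 2) → ℂ :=
  fun x => ∑ u : ι → Fin 2, K (x ∘ e) u * f (Function.extend e u x)

/-- Restricting to fewer coordinates preserves covering: the frozen coordinates are absorbed into
the functional. -/
theorem Covers.mono {J : Type} {m n : Finset Q} {r : J → (Q → Fin 2) → ℂ}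
    {ξ : (Q → Fin 2) → ℂ} (hmn : m ⊆ n) (h : Covers n r ξ) : Covers m r ξ := by
  intro w hw hr x
  have key : ∀ (f : (Q → Fin 2) → ℂ) (x' : Q → Fin 2),
      ∑ y ∈ box n x', (if ∀ i ∈ n \ m, y i = x i then w y else 0) * f y =
        ∑ y ∈ box m ((n \ m).piecewise x x'), w y * f y := by
    intro f x'
    rw [← sum_box_freeze hmn]
    simp only [ite_mul, zero_mul]
  have h1 := h (fun y => if ∀ i ∈ n \ m, y i = x i then w y else 0) ?_ ?_ x
  · rw [key, Finset.piecewise_same] at h1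
    exact h1
  · intro y z hyz
    have e1 : w y = w z := hw fun i hi => hyz i (hmn hi)
    have e2 : (∀ i ∈ n \ m, y i = x i) ↔ ∀ i ∈ n \ m, z i = x i :=
      forall₂_congr fun i hi => by rw [hyz i (Finset.mem_sdiff.1 hi).1]
    simp only [e1, e2]
  · intro j x'
    rw [key]
    exact hr j _

theorem sum_box_comm (n v : Finset Q) (hv : v ⊆ n) (x : Q → Fin 2)
    (g : (Q → Fin 2) → (Q → Fin 2) → ℂ) :
    ∑ y ∈ box n x, ∑ z ∈ box v y, g y z = ∑ z ∈ box n x, ∑ y ∈ box v z, g y z := by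
  refine Finset.sum_comm' fun y z => ?_
  simp only [mem_box]
  grind

theorem act_eq_sum_box {ι : Type} [Fintype ι] [DecidableEq ι] (e : ι ↪ Q) (K : Op ι)
    (f : (Q → Fin 2) → ℂ) (x : Q → Fin 2) :
    act e K f x = ∑ y ∈ box (Finset.univ.map e) x, K (x ∘ e) (y ∘ e) * f y := by
  unfold act
  refine Finset.sum_bij (fun u _ => Function.extend e u x) ?_ ?_ ?_ ?_
  · intro u _
    rw [mem_box]
    intro i hi
    refine Function.extend_apply' _ _ _ ?_
    rintro ⟨a, rfl⟩
    exact hi (by simp)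
  · intro u _ u' _ h
    exact Function.extend_injective e.injective x h
  · intro y hy
    refine ⟨y ∘ e, Finset.mem_univ _, funext fun i => ?_⟩
    by_cases hi : ∃ a, e a = i
    · obtain ⟨a, rfl⟩ := hi
      rw [e.injective.extend_apply]; rfl
    · rw [Function.extend_apply' _ _ _ hi, mem_box.1 hy]
      simpa using hi
  · intro u _
    rw [Function.extend_comp e.injective]

/-- Operators inside `n` may be moved to the other side of the pairing. -/
theorem kills_act_iff {ι : Type} [Fintype ι] [DecidableEq ι] {n : Finset Q} (e : ι ↪ Q)
    (he : ∀ i, e i ∈ n) (K : Op ι) (w ξ : (Q → Fin 2) → ℂ) :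
    Kills n w (act e K ξ) ↔ Kills n (act e K.transpose w) ξ := by
  refine forall_congr' fun x => ?_
  simp only [act_eq_sum_box, Finset.mul_sum, Finset.sum_mul]
  rw [sum_box_comm n _ (fun i hi => by obtain ⟨a, -, rfl⟩ := Finset.mem_map.1 hi; exact he a)]
  simp only [Matrix.transpose_apply]
  refine Eq.congr (Finset.sum_congr rfl fun y _ => Finset.sum_congr rfl fun z _ => ?_) rfl
  ring

theorem dependsOn_act {ι : Type} [Fintype ι] [DecidableEq ι] {κ : Type} {n : Set κ} (e : ι ↪ κ)
    (he : ∀ i, e i ∈ n) (K : Op ι) {w : (κ → Fin 2) → ℂ} (hw : DependsOn w n) :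
    DependsOn (act e K w) n := by
  intro x y hxy
  refine Finset.sum_congr rfl fun u _ => ?_
  have h1 : x ∘ e = y ∘ e := funext fun i => hxy _ (he i)
  rw [h1, hw (x := Function.extend e u x) (y := Function.extend e u y)]
  intro i hi
  by_cases h : ∃ a, e a = i
  · obtain ⟨a, rfl⟩ := h
    rw [e.injective.extend_apply, e.injective.extend_apply]
  · rw [Function.extend_apply' _ _ _ h, Function.extend_apply' _ _ _ h, hxy i hi]

/-- An operation with Kraus operators `K b` on coordinates in `n` may be applied on both sides. -/
theorem Covers.act_inside {J B ι : Type} [Fintype ι] [DecidableEq ι] {n : Finset Q}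
    {r : J → (Q → Fin 2) → ℂ} {ξ : (Q → Fin 2) → ℂ} (h : Covers n r ξ) (e : ι ↪ Q)
    (he : ∀ i, e i ∈ n) (K : B → Op ι) (b : B) :
    Covers n (fun j : B × J => act e (K j.1) (r j.2)) (act e (K b) ξ) := by
  intro w hw hr
  rw [kills_act_iff e he]
  refine h _ (dependsOn_act e (fun i => he i) _ hw) fun j => ?_
  rw [← kills_act_iff e he]
  exact hr (b, j)

theorem Kills.act_outside {ι : Type} [Fintype ι] [DecidableEq ι] {n : Finset Q}
    {w ξ : (Q → Fin 2) → ℂ} (hw : DependsOn w n) (h : Kills n w ξ) (e : ι ↪ Q)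
    (he : ∀ i, e i ∉ n) (A : Op ι) : Kills n w (act e A ξ) := by
  intro x
  have swap : ∀ (u : n → Fin 2) (a : ι → Fin 2),
      Function.extend e a (patch u x) = patch u (Function.extend e a x) := by
    intro u a
    funext i
    by_cases hi : ∃ k, e k = i
    · obtain ⟨k, rfl⟩ := hi
      rw [e.injective.extend_apply, patch_notMem _ _ (he k), e.injective.extend_apply]
    · rw [Function.extend_apply' _ _ _ hi]
      by_cases hin : i ∈ n
      · rw [patch_mem _ _ hin, patch_mem _ _ hin]
      · rw [patch_notMem _ _ hin, patch_notMem _ _ hin, Function.extend_apply' _ _ _ hi]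
  have hx : ∀ u : n → Fin 2, patch u x ∘ e = x ∘ e := fun u =>
    funext fun k => patch_notMem _ _ (he k)
  have hwx : ∀ (u : n → Fin 2) (a : ι → Fin 2),
      w (patch u x) = w (patch u (Function.extend e a x)) := fun u a => hw fun i hi => by
    rw [patch_mem _ _ hi, patch_mem _ _ hi]
  rw [sum_box]
  simp only [act, hx, swap, Finset.mul_sum]
  rw [Finset.sum_comm]
  refine Finset.sum_eq_zero fun a _ => ?_
  have h1 := h (Function.extend e a x)
  rw [sum_box] at h1
  calc ∑ u : n → Fin 2, w (patch u x) * (A (x ∘ e) a * ξ (patch u (Function.extend e a x)))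
      = A (x ∘ e) a * ∑ u : n → Fin 2, w (patch u (Function.extend e a x)) *
          ξ (patch u (Function.extend e a x)) := by
        rw [Finset.mul_sum]
        refine Finset.sum_congr rfl fun u _ => ?_
        rw [hwx u a]
        ring
    _ = 0 := by rw [h1, mul_zero]

/-- An operator outside `n` only takes linear combinations of slices over `n`. -/
theorem Covers.act_outside {J ι : Type} [Fintype ι] [DecidableEq ι] {n : Finset Q}
    {r : J → (Q → Fin 2) → ℂ} {ξ : (Q → Fin 2) → ℂ} (h : Covers n r ξ) (e : ι ↪ Q)
    (he : ∀ i, e i ∉ n) (A : Op ι) : Covers n r (act e A ξ) :=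
  fun w hw hr => (h w hw hr).act_outside hw e he A

theorem Kills.comp_update {n : Finset Q} {w ξ : (Q → Fin 2) → ℂ} (hw : DependsOn w n)
    (h : Kills n w ξ) {p : Q} (hp : p ∉ n) (b : Fin 2) :
    Kills n w (fun x => ξ (Function.update x p b)) := by
  intro x
  have h1 := h (Function.update x p b)
  rw [sum_box] at h1 ⊢
  rw [← h1]
  refine Finset.sum_congr rfl fun u _ => ?_
  have e1 : Function.update (patch u x) p b = patch u (Function.update x p b) := by
    funext i
    by_cases hi : i = p
    · subst hi
      rw [patch_notMem _ _ hp]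
      simp
    · rw [Function.update_of_ne hi]
      by_cases hin : i ∈ n
      · rw [patch_mem _ _ hin, patch_mem _ _ hin]
      · rw [patch_notMem _ _ hin, patch_notMem _ _ hin, Function.update_of_ne hi]
  beta_reduce
  rw [e1, hw (x := patch u x) (y := patch u (Function.update x p b))]
  intro i hi
  rw [patch_mem _ _ hi, patch_mem _ _ hi]

/-- Passing to the slices in `p`, as the partial trace over `p` does, loses nothing away from
`p`. -/
theorem Covers.free {J : Type} {n : Finset Q} {r : J → (Q → Fin 2) → ℂ}
    {ξ : (Q → Fin 2) → ℂ} (h : Covers n r ξ) {p : Q} (hp : p ∉ n) :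
    Covers n (fun (j : J × Fin 2) x => r j.1 (Function.update x p j.2)) ξ := by
  refine fun w hw hr => h w hw fun j x => ?_
  rw [← hr (j, x p) x]
  refine Finset.sum_congr rfl fun y hy => ?_
  simp only [← mem_box.1 hy p hp, Function.update_eq_self]

/-- The family that describes a freshly allocated, completely mixed qubit `p`, the previous
content of `p` being renamed to `s`. -/
def allocFamily {J : Type} (p s : Q) (r : J → (Q → Fin 2) → ℂ) (j : J × Fin 2)
    (x : Q → Fin 2) : ℂ :=
  if x p = j.2 then r j.1 (x ∘ Equiv.swap p s) else 0

/-- A fresh, completely mixed qubit `p` imposes no condition on the coordinate `p`.  Any qubit of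
that name has to be discarded on the side of the covering family, whence the covering over `m`
with `p ∉ m`. -/
theorem Covers.alloc {J : Type} {m d : Finset Q} {r : J → (Q → Fin 2) → ℂ}
    {ξ : (Q → Fin 2) → ℂ} (h : Covers m r ξ) {p s : Q} (hp : p ∉ m) (hs : s ∉ d) (hmd : m ⊆ d)
    (hps : p ≠ s) (hr : ∀ j, DependsOn (r j) d) :
    Covers (insert p m) (allocFamily p s r) ξ := by
  intro w hw hk x
  rw [sum_box_insert hp]
  refine Finset.sum_eq_zero fun b _ => ?_
  have hwb : DependsOn (fun y => w (Function.update y p b)) (m : Set Q) := by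
    intro y z hyz
    refine hw fun i hi => ?_
    by_cases hip : i = p
    · subst hip; simp
    · rw [Function.update_of_ne hip, Function.update_of_ne hip]
      exact hyz i ((Finset.mem_insert.1 hi).resolve_left hip)
  have h1 := h (fun y => w (Function.update y p b)) hwb ?_ (Function.update x p b)
  · rw [← h1]
    refine Finset.sum_congr rfl fun y hy => ?_
    have : y p = b := by rw [mem_box.1 hy p hp]; simp
    simp only [← this, Function.update_eq_self]
  · intro j x₀
    -- the sum over `p` in the pairing with `allocFamily p s r (j, b)` has only the term `b`
    have h2 := hk (j, b) (Function.update (x₀ ∘ Equiv.swap p s) p b)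
    rw [sum_box_insert hp, Finset.sum_eq_single b] at h2
    · rw [sum_box] at h2 ⊢
      rw [← h2]
      refine Finset.sum_congr rfl fun u _ => ?_
      rw [Function.update_idem]
      congr 1
      · refine hw fun i hi => ?_
        by_cases hip : i = p
        · subst hip
          rw [patch_notMem _ _ hp]
          simp
        · have him := (Finset.mem_insert.1 hi).resolve_left hip
          rw [Function.update_of_ne hip, patch_mem _ _ him, patch_mem _ _ him]
      · have hpb : patch u (Function.update (x₀ ∘ Equiv.swap p s) p b) p = b := by
          rw [patch_notMem _ _ hp]; simp
        rw [allocFamily, if_pos hpb]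
        refine hr j fun i hi => ?_
        have his : i ≠ s := fun h => hs (h ▸ hi)
        have hsm : s ∉ m := fun h => hs (hmd h)
        rw [Function.comp_apply]
        by_cases hip : i = p
        · subst hip
          rw [patch_notMem _ _ hp, Equiv.swap_apply_left, patch_notMem _ _ hsm,
            Function.update_of_ne hps.symm]
          simp
        · rw [Equiv.swap_apply_of_ne_of_ne hip his]
          by_cases him : i ∈ m
          · rw [patch_mem _ _ him, patch_mem _ _ him]
          · rw [patch_notMem _ _ him, patch_notMem _ _ him, Function.update_of_ne hip,
              Function.comp_apply, Equiv.swap_apply_of_ne_of_ne hip his]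
    · intro c _ hc
      refine Finset.sum_eq_zero fun y hy => ?_
      have : y p = c := by rw [mem_box.1 hy p hp]; simp
      rw [allocFamily, if_neg (by rw [this]; exact hc), mul_zero]
    · simp

theorem Covers.eq_zero {J : Type} {n : Finset Q} {r : J → (Q → Fin 2) → ℂ}
    {ξ : (Q → Fin 2) → ℂ} (h : Covers n r ξ) (hr : ∀ j, r j = 0) : ξ = 0 := by
  funext x
  have h1 := h (fun y => if ∀ i ∈ n, y i = x i then 1 else 0) ?_ ?_ x
  · simp only [ite_mul, one_mul, zero_mul] at h1
    rwa [sum_box_point, Finset.piecewise_same] at h1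
  · intro y z hyz
    have : (∀ i ∈ n, y i = x i) ↔ ∀ i ∈ n, z i = x i :=
      forall₂_congr fun i hi => by rw [hyz i hi]
    simp only [this]
  · intro j x'
    simp [hr j]

/-- A linear relation between the values at two labels that are prescribed on `n` passes from a
covering family to the functions that it covers. -/
theorem Covers.eq_of_eq {J : Type} {n : Finset Q} {r : J → (Q → Fin 2) → ℂ}
    {ξ : (Q → Fin 2) → ℂ} (h : Covers n r ξ) (s t : ℂ) (a b : Q → Fin 2)
    (hr : ∀ j x, s * r j (n.piecewise a x) = t * r j (n.piecewise b x)) (x : Q → Fin 2) :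
    s * ξ (n.piecewise a x) = t * ξ (n.piecewise b x) := by
  have key : ∀ (f : (Q → Fin 2) → ℂ) (x : Q → Fin 2),
      ∑ y ∈ box n x, ((if ∀ i ∈ n, y i = a i then s else 0) -
        (if ∀ i ∈ n, y i = b i then t else 0)) * f y =
      s * f (n.piecewise a x) - t * f (n.piecewise b x) := by
    intro f x
    rw [← sum_box_point n x a (fun y => s * f y), ← sum_box_point n x b (fun y => t * f y),
      ← Finset.sum_sub_distrib]
    refine Finset.sum_congr rfl fun y _ => ?_
    split_ifs <;> ring
  have h1 := h (fun y => (if ∀ i ∈ n, y i = a i then s else 0) -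
        (if ∀ i ∈ n, y i = b i then t else 0)) ?_ ?_ x
  · rw [key] at h1
    exact sub_eq_zero.1 h1
  · intro y z hyz
    have e : ∀ c : Q → Fin 2, (∀ i ∈ n, y i = c i) ↔ ∀ i ∈ n, z i = c i := fun c =>
      forall₂_congr fun i hi => by rw [hyz i hi]
    simp only [e]
  · intro j x'
    rw [key, hr, sub_self]

end Labels

/-! ### Superoperators -/

section SuperOperators

set_option linter.unusedSectionVars false

variable {ι κ : Type} [Fintype ι] [DecidableEq ι] [Fintype κ] [DecidableEq κ]

/-- The superoperator `A ↦ K A L†`. -/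
def sand (K L : Op ι) : SuperOp ι where
  toFun A := K * A * L.conjTranspose
  map_add' A B := by simp [Matrix.mul_add, Matrix.add_mul]
  map_smul' c A := by simp

theorem conjOp_eq_sand (K : Op ι) : conjOp K = sand K K := rfl

theorem sand_comp (K L K' L' : Op ι) : sand K' L' ∘ₗ sand K L = sand (K' * K) (L' * L) := by
  ext1 A
  simp [sand, Matrix.mul_assoc]

/-- The matrix `K ⊗ I`, with `K` acting on the qubits `e i`. -/
def liftMat (e : ι ↪ κ) (K : Op ι) : Op κ :=
  open Classical in
  Matrix.of fun x y => if ∀ i, (¬∃ a, e a = i) → y i = x i then K (x ∘ e) (y ∘ e) else 0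

theorem liftMat_mulVec (e : ι ↪ κ) (K : Op ι) (f : (κ → Fin 2) → ℂ) :
    (liftMat e K).mulVec f = act e K f := by
  classical
  funext x
  simp only [Matrix.mulVec, dotProduct, liftMat, Matrix.of_apply, act, ite_mul, zero_mul]
  rw [← Finset.sum_filter]
  symm
  refine Finset.sum_bij (fun u _ => Function.extend e u x) ?_ ?_ ?_ ?_
  · intro u _
    simp only [Finset.mem_filter, Finset.mem_univ, true_and]
    exact fun i hi => Function.extend_apply' _ _ _ hi
  · intro u _ u' _ h
    exact Function.extend_injective e.injective x h
  · intro y hy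
    refine ⟨y ∘ e, Finset.mem_univ _, funext fun i => ?_⟩
    by_cases hi : ∃ a, e a = i
    · obtain ⟨a, rfl⟩ := hi
      rw [e.injective.extend_apply]; rfl
    · rw [Function.extend_apply' _ _ _ hi, (Finset.mem_filter.1 hy).2 i hi]
  · intro u _
    rw [Function.extend_comp e.injective]

/-- The entries of `K A L†`, with `K` and `L` acting on vectors. -/
theorem sand_apply (K L A : Op ι) (x y : ι → Fin 2) :
    sand K L A x y = K.mulVec (fun u => star (L.mulVec (fun v => star (A u v)) y)) x := by
  simp only [sand, LinearMap.coe_mk, AddHom.coe_mk, Matrix.mulVec, dotProduct, Matrix.mul_assoc,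
    Matrix.mul_apply, Matrix.conjTranspose_apply, star_sum, star_mul', star_star]
  simp only [mul_comm]

/-- Lifting commutes with the passage from matrices to superoperators. -/
theorem liftOp_sand (e : ι ↪ κ) (K L : Op ι) :
    liftOp e (sand K L) = sand (liftMat e K) (liftMat e L) := by
  ext1 A
  ext x y
  rw [sand_apply]
  simp only [liftMat_mulVec]
  simp only [liftOp, LinearMap.coe_mk, AddHom.coe_mk, Matrix.of_apply, sand_apply, act,
    Matrix.mulVec, dotProduct]

/-- `liftOp e` as a linear map. -/
def liftOpHom (e : ι ↪ κ) : SuperOp ι →ₗ[ℂ] SuperOp κ where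
  toFun := liftOp e
  map_add' _ _ := rfl
  map_smul' _ _ := rfl

theorem liftOp_sum {J : Type} [Fintype J] (e : ι ↪ κ) (E : J → SuperOp ι) :
    liftOp e (∑ j, E j) = ∑ j, liftOp e (E j) := map_sum (liftOpHom e) E Finset.univ

theorem liftOp_id (e : ι ↪ κ) : liftOp e LinearMap.id = LinearMap.id := by
  ext1 A
  ext x y
  have h : ∀ x : κ → Fin 2, Function.extend e (x ∘ e) x = x := fun x => by
    funext i
    by_cases hi : ∃ a, e a = i
    · obtain ⟨a, rfl⟩ := hi
      rw [e.injective.extend_apply]; rfl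
    · rw [Function.extend_apply' _ _ _ hi]
  simp [liftOp, h]

/-- The span of the superoperators `A ↦ K A L†` with `K` and `L` in `T`. -/
def sandSpan (T : Set (Op ι)) : Submodule ℂ (SuperOp ι) :=
  Submodule.span ℂ {E | ∃ K ∈ T, ∃ L ∈ T, E = sand K L}

theorem sand_mem_sandSpan {T : Set (Op ι)} {K L : Op ι} (hK : K ∈ T) (hL : L ∈ T) :
    sand K L ∈ sandSpan T :=
  Submodule.subset_span ⟨K, hK, L, hL, rfl⟩

theorem comp_mem_sandSpan {T T' T'' : Set (Op ι)} {F G : SuperOp ι} (hF : F ∈ sandSpan T)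
    (hG : G ∈ sandSpan T') (hT : ∀ K ∈ T, ∀ L ∈ T', L * K ∈ T'') : G ∘ₗ F ∈ sandSpan T'' := by
  induction hG using Submodule.span_induction with
  | zero => rw [LinearMap.zero_comp]; exact Submodule.zero_mem _
  | add x y _ _ hx hy => rw [LinearMap.add_comp]; exact Submodule.add_mem _ hx hy
  | smul c x _ hx => rw [LinearMap.smul_comp]; exact Submodule.smul_mem _ c hx
  | mem G hG =>
    obtain ⟨K', hK', L', hL', rfl⟩ := hG
    induction hF using Submodule.span_induction with
    | zero => rw [LinearMap.comp_zero]; exact Submodule.zero_mem _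
    | add x y _ _ hx hy => rw [LinearMap.comp_add]; exact Submodule.add_mem _ hx hy
    | smul c x _ hx => rw [LinearMap.comp_smul]; exact Submodule.smul_mem _ c hx
    | mem F hF =>
      obtain ⟨K, hK, L, hL, rfl⟩ := hF
      rw [sand_comp]
      exact sand_mem_sandSpan (hT _ hK _ hK') (hT _ hL _ hL')

/-- Every superoperator is a linear combination of maps `A ↦ K A L†`. -/
theorem mem_sandSpan_univ (E : SuperOp ι) : E ∈ sandSpan (Set.univ : Set (Op ι)) := by
  have h : E = ∑ x : ι → Fin 2, ∑ y : ι → Fin 2, ∑ u : ι → Fin 2, ∑ v : ι → Fin 2,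
      E (Matrix.single u v 1) x y • sand (Matrix.single x u 1) (Matrix.single y v 1) := by
    ext1 A
    ext a b
    conv_lhs => rw [Matrix.matrix_eq_sum_single A]
    simp only [map_sum, LinearMap.sum_apply, Matrix.sum_apply, LinearMap.smul_apply,
      Matrix.smul_apply, smul_eq_mul]
    have hs : ∀ x y u v : ι → Fin 2,
        sand (Matrix.single x u 1) (Matrix.single y v 1) A a b =
          if x = a ∧ y = b then A u v else 0 := by
      intro x y u v
      simp [sand, Matrix.single_apply]
    simp only [hs]
    conv_rhs =>
      rw [Finset.sum_eq_single a (fun x _ hx => by simp [hx]) (by simp),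
        Finset.sum_eq_single b (fun x _ hx => by simp [hx]) (by simp)]
    refine Finset.sum_congr rfl fun u _ => Finset.sum_congr rfl fun v _ => ?_
    have : Matrix.single u v (A u v) = A u v • Matrix.single u v 1 := by simp
    rw [this, map_smul]
    simp [mul_comm]
  rw [h]
  exact Submodule.sum_mem _ fun x _ => Submodule.sum_mem _ fun y _ => Submodule.sum_mem _
    fun u _ => Submodule.sum_mem _ fun v _ => Submodule.smul_mem _ _
      (sand_mem_sandSpan trivial trivial)

theorem liftOp_mem_sandSpan {e : ι ↪ κ} {T : Set (Op ι)} {E : SuperOp ι} (hE : E ∈ sandSpan T)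
    {T' : Set (Op κ)} (hT : ∀ K ∈ T, liftMat e K ∈ T') : liftOp e E ∈ sandSpan T' := by
  have h : sandSpan T ≤ (sandSpan T').comap (liftOpHom e) := Submodule.span_le.2 ?_
  · exact h hE
  rintro _ ⟨K, hK, L, hL, rfl⟩
  change liftOp e (sand K L) ∈ sandSpan T'
  rw [liftOp_sand]
  exact sand_mem_sandSpan (hT _ hK) (hT _ hL)

/-- A superoperator built from matrices of the form `K ⊗ I` has itself the form `E ⊗ I`. -/
theorem exists_eq_liftOp {e : ι ↪ κ} {T : Set (Op κ)} {E : SuperOp κ} (hE : E ∈ sandSpan T)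
    (hT : ∀ K ∈ T, ∃ K', K = liftMat e K') : ∃ E', E = liftOp e E' := by
  have : sandSpan T ≤ LinearMap.range (liftOpHom e) := by
    refine Submodule.span_le.2 ?_
    rintro _ ⟨K, hK, L, hL, rfl⟩
    obtain ⟨K', rfl⟩ := hT K hK
    obtain ⟨L', rfl⟩ := hT L hL
    exact ⟨sand K' L', liftOp_sand e K' L'⟩
  obtain ⟨E', h⟩ := this hE
  exact ⟨E', h.symm⟩

/-! ### Quantum operations -/

/-- The ampliation `E ⊗ I_k` of a superoperator. -/
def ampl {ι k : Type} (E : SuperOp ι) (A : Matrix ((ι → Fin 2) × k) ((ι → Fin 2) × k) ℂ) :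
    Matrix ((ι → Fin 2) × k) ((ι → Fin 2) × k) ℂ :=
  Matrix.of fun x y => E (Matrix.of fun u v => A (u, x.2) (v, y.2)) x.1 y.1

theorem IsCompletelyPositive.ampl_posSemidef {ι k : Type} [Fintype k] {E : SuperOp ι}
    (hE : IsCompletelyPositive E) {A : Matrix ((ι → Fin 2) × k) ((ι → Fin 2) × k) ℂ}
    (hA : A.PosSemidef) : (ampl E A).PosSemidef := by
  have h := hE (Fintype.card k)
    (A.submatrix (Prod.map id (Fintype.equivFin k).symm) (Prod.map id (Fintype.equivFin k).symm))
    (hA.submatrix _)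
  have h2 := h.submatrix (Prod.map id (Fintype.equivFin k))
  convert h2 using 1
  ext x y
  simp [ampl]

theorem IsCompletelyPositive.posSemidef {ι : Type} {E : SuperOp ι}
    (hE : IsCompletelyPositive E) {A : Op ι} (hA : A.PosSemidef) : (E A).PosSemidef :=
  (hE.ampl_posSemidef (k := Unit) (hA.submatrix Prod.fst)).submatrix (fun x => (x, ()))

theorem IsCompletelyPositive.comp {ι : Type} {E F : SuperOp ι} (hE : IsCompletelyPositive E)
    (hF : IsCompletelyPositive F) : IsCompletelyPositive (E ∘ₗ F) :=
  fun _ _ hA => hE.ampl_posSemidef (hF.ampl_posSemidef hA)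

theorem isCompletelyPositive_sum {J : Type} [Fintype J] {E : J → SuperOp ι}
    (hE : ∀ j, IsCompletelyPositive (E j)) : IsCompletelyPositive (∑ j, E j) := by
  intro k A hA
  have h := Matrix.posSemidef_sum Finset.univ fun j _ => hE j k A hA
  convert h using 1
  ext x y
  simp [Matrix.sum_apply]

theorem isCompletelyPositive_conjOp (K : Op ι) : IsCompletelyPositive (conjOp K) := by
  intro k A hA
  have h := hA.mul_mul_conjTranspose_same (Matrix.kroneckerMap (· * ·) K (1 : Matrix (Fin k) _ ℂ))
  convert h using 1
  ext ⟨x, i⟩ ⟨y, j⟩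
  simp [conjOp, Matrix.mul_apply, Fintype.sum_prod_type, Matrix.one_apply, apply_ite]

theorem IsCompletelyPositive.liftOp {E : SuperOp ι} (hE : IsCompletelyPositive E) (e : ι ↪ κ) :
    IsCompletelyPositive (liftOp e E) := by
  intro k A hA
  -- the whole label of `κ` serves as an ancilla that records the label outside the range of `e`
  exact (hE.ampl_posSemidef (k := (κ → Fin 2) × Fin k)
    (hA.submatrix fun t => (Function.extend e t.1 t.2.1, t.2.2))).submatrix
      (fun t : (κ → Fin 2) × Fin k => (t.1 ∘ e, t))

theorem sum_sum_extend (e : ι ↪ κ) (g : (κ → Fin 2) → ℂ) :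
    ∑ x : κ → Fin 2, ∑ a : ι → Fin 2, g (Function.extend e a x) =
      Fintype.card (ι → Fin 2) * ∑ x, g x := by
  have hinv : Function.Involutive fun t : (κ → Fin 2) × (ι → Fin 2) =>
      (Function.extend e t.2 t.1, t.1 ∘ e) := by
    rintro ⟨x, a⟩
    refine Prod.ext (funext fun i => ?_) (Function.extend_comp e.injective _ _)
    by_cases hi : ∃ k, e k = i
    · obtain ⟨k, rfl⟩ := hi
      simp [e.injective.extend_apply]
    · simp [Function.extend_apply' _ _ _ hi]
  have h := Equiv.sum_comp hinv.toPerm (fun t : (κ → Fin 2) × (ι → Fin 2) => g t.1)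
  rw [Fintype.sum_prod_type, Fintype.sum_prod_type] at h
  refine Eq.trans h ?_
  simp [Finset.mul_sum]

/-- The trace of a lifted operation is the sum of the traces of the images of the diagonal blocks.
The sum runs over all labels `x`, so that each block is counted once for each label of `ι`. -/
theorem card_mul_trace_liftOp (e : ι ↪ κ) (E : SuperOp ι) (A : Op κ) :
    Fintype.card (ι → Fin 2) * (liftOp e E A).trace = ∑ x : κ → Fin 2,
      (E (Matrix.of fun u v => A (Function.extend e u x) (Function.extend e v x))).trace := by
  simp only [Matrix.trace, Matrix.diag_apply]
  rw [← sum_sum_extend e]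
  refine Finset.sum_congr rfl fun x _ => Finset.sum_congr rfl fun a _ => ?_
  have h : ∀ u, Function.extend e u (Function.extend e a x) = Function.extend e u x := fun u =>
    funext fun i => by
      by_cases hi : ∃ k, e k = i
      · obtain ⟨k, rfl⟩ := hi
        simp [e.injective.extend_apply]
      · simp [Function.extend_apply' _ _ _ hi]
  simp only [liftOp, LinearMap.coe_mk, AddHom.coe_mk, Matrix.of_apply, h,
    Function.extend_comp e.injective]

theorem card_mul_trace (e : ι ↪ κ) (A : Op κ) :
    Fintype.card (ι → Fin 2) * A.trace = ∑ x : κ → Fin 2,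
      (Matrix.of fun u v => A (Function.extend e u x) (Function.extend e v x)).trace := by
  have h := card_mul_trace_liftOp e LinearMap.id A
  rwa [liftOp_id] at h

theorem trace_liftOp {e : ι ↪ κ} {E : SuperOp ι} (hE : ∀ A, (E A).trace = A.trace) (A : Op κ) :
    (liftOp e E A).trace = A.trace := by
  have h : (Fintype.card (ι → Fin 2) : ℂ) ≠ 0 := by simp
  refine mul_left_cancel₀ h ?_
  rw [card_mul_trace_liftOp, card_mul_trace e]
  simp only [hE]

theorem IsQuantumOp.comp {E F : SuperOp ι} (hE : IsQuantumOp E) (hF : IsQuantumOp F) :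
    IsQuantumOp (E ∘ₗ F) :=
  ⟨hE.1.comp hF.1, fun A hA => (hE.2 _ (hF.1.posSemidef hA)).trans (hF.2 A hA)⟩

theorem isQuantumOp_id : IsQuantumOp (LinearMap.id : SuperOp ι) :=
  ⟨fun _ _ hA => hA, fun _ _ => le_rfl⟩

theorem IsQuantumOp.liftOp {E : SuperOp ι} (hE : IsQuantumOp E) (e : ι ↪ κ) :
    IsQuantumOp (liftOp e E) := by
  refine ⟨hE.1.liftOp e, fun A hA => ?_⟩
  have h0 : (0 : ℝ) < Fintype.card (ι → Fin 2) := by exact_mod_cast Fintype.card_pos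
  have h1 := congrArg Complex.re (card_mul_trace_liftOp e E A)
  have h2 := congrArg Complex.re (card_mul_trace e A)
  rw [Complex.re_sum, ← Complex.ofReal_natCast, Complex.re_ofReal_mul] at h1 h2
  refine le_of_mul_le_mul_left ?_ h0
  rw [h1, h2]
  exact Finset.sum_le_sum fun x _ => hE.2 _ (hA.submatrix fun u => Function.extend e u x)

/-- If `E ⊗ I` is a quantum operation, so is `E`.  The identity factor is fed with the positive
matrix all of whose entries are `1`, so that every block of the input is the given operator. -/
theorem isQuantumOp_of_liftOp {E : SuperOp ι} {e : ι ↪ κ} (h : IsQuantumOp (liftOp e E)) :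
    IsQuantumOp E := by
  refine ⟨fun k A hA => ?_, fun A hA => ?_⟩
  · have h1 := (h.1.ampl_posSemidef (hA.submatrix
      fun t : (κ → Fin 2) × Fin k => (t.1 ∘ e, t.2))).submatrix
        fun t : (ι → Fin 2) × Fin k => (Function.extend e t.1 0, t.2)
    convert h1 using 1
    ext x y
    simp [ampl, QSL.liftOp, Function.extend_comp e.injective]
  · have h1 := h.2 _ (hA.submatrix fun x : κ → Fin 2 => x ∘ e)
    have h2 := card_mul_trace_liftOp e E (A.submatrix (fun x => x ∘ e) fun x => x ∘ e)
    have h3 := card_mul_trace e (A.submatrix (fun x => x ∘ e) fun x => x ∘ e)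
    simp only [Matrix.submatrix_apply, Function.extend_comp e.injective,
      Finset.sum_const, Finset.card_univ, nsmul_eq_mul] at h2 h3
    have h2' := congrArg Complex.re h2
    have h3' := congrArg Complex.re h3
    simp only [← Complex.ofReal_natCast, Complex.re_ofReal_mul] at h2' h3'
    have hι : (0 : ℝ) < Fintype.card (ι → Fin 2) := by exact_mod_cast Fintype.card_pos
    have hκ : (0 : ℝ) < Fintype.card (κ → Fin 2) := by exact_mod_cast Fintype.card_pos
    have h4 := mul_le_mul_of_nonneg_left h1 hι.le
    rw [h2', h3'] at h4
    exact le_of_mul_le_mul_left h4 hκ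

theorem trace_sum_conjOp {J : Type} [Fintype J] {K : J → Op ι}
    (hK : ∑ j, (K j).conjTranspose * K j = 1) (A : Op ι) :
    ∑ j, (conjOp (K j) A).trace = A.trace := by
  have : ∀ j, (conjOp (K j) A).trace = ((K j).conjTranspose * K j * A).trace := fun j => by
    simp only [conjOp, LinearMap.coe_mk, AddHom.coe_mk]
    rw [Matrix.trace_mul_comm, ← Matrix.mul_assoc]
  simp only [this]
  rw [← Matrix.trace_sum, ← Finset.sum_mul, hK, one_mul]

theorem isQuantumOp_conjOp {J : Type} [Fintype J] {K : J → Op ι}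
    (hK : ∑ j, (K j).conjTranspose * K j = 1) (j : J) : IsQuantumOp (conjOp (K j)) := by
  refine ⟨isCompletelyPositive_conjOp _, fun A hA => ?_⟩
  rw [← trace_sum_conjOp hK A, Complex.re_sum]
  exact Finset.single_le_sum (f := fun j => (conjOp (K j) A).trace.re)
    (fun i _ => (Complex.le_def.1
      ((isCompletelyPositive_conjOp (K i)).posSemidef hA).trace_nonneg).1) (Finset.mem_univ j)

theorem isQuantumOp_sum_conjOp {J : Type} [Fintype J] {K : J → Op ι}
    (hK : ∑ j, (K j).conjTranspose * K j = 1) : IsQuantumOp (∑ j, conjOp (K j)) := by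
  refine ⟨isCompletelyPositive_sum fun j => isCompletelyPositive_conjOp _, fun A _ => ?_⟩
  rw [LinearMap.sum_apply, Matrix.trace_sum, trace_sum_conjOp hK]

end SuperOperators

theorem sum_single_conjTranspose_mul (n : ℕ) :
    ∑ b : Fin n → Fin 2, (Matrix.single (fun _ => 0) b 1 : Op (Fin n)).conjTranspose *
      Matrix.single (fun _ => 0) b 1 = 1 := by
  simp [Matrix.conjTranspose_single, Matrix.sum_single_one]

theorem Measurement.sum_conjTranspose_mul {n k : ℕ} (M : Measurement n k) :
    ∑ m, (M.P m).conjTranspose * M.P m = 1 := by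
  rw [← M.sum_eq_one]
  refine Finset.sum_congr rfl fun m _ => ?_
  have h := M.isProj m
  have h1 : (M.P m).conjTranspose = M.P m := h.isSelfAdjoint
  rw [h1]
  exact h.isIdempotentElem

/-! ### Heaps as families of vectors -/

/-- The restriction of a basis label to a domain. -/
def res (d : Finset QDomain) (x : QDomain → Fin 2) : d → Fin 2 := fun i => x i

theorem res_patch {d : Finset QDomain} (u : d → Fin 2) (x : QDomain → Fin 2) :
    res d (patch u x) = u := patch_comp_val u x

/-- Up to a nonzero factor, the operator `ρ` is the sum of the rank one operators given by the
vectors `r j`, which are encoded as functions of all labels. -/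
def Rep {d : Finset QDomain} {J : Type} [Fintype J] (ρ : Op d)
    (r : J → (QDomain → Fin 2) → ℂ) : Prop :=
  (∀ j, DependsOn (r j) d) ∧ ∃ c : ℂ, c ≠ 0 ∧
    ∀ x y, ρ (res d x) (res d y) = c * ∑ j, r j x * star (r j y)

open scoped MatrixOrder Matrix.Norms.L2Operator in
theorem exists_rep {d : Finset QDomain} {ρ : Op d} (hρ : ρ.PosSemidef) :
    ∃ r : (d → Fin 2) → (QDomain → Fin 2) → ℂ, Rep ρ r := by
  obtain ⟨B, rfl⟩ := CStarAlgebra.nonneg_iff_eq_star_mul_self.1 hρ.nonneg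
  refine ⟨fun j x => star (B j (res d x)), fun j x y hxy => ?_, 1, one_ne_zero, fun x y => ?_⟩
  · have : res d x = res d y := funext fun i => hxy i i.2
    simp only [this]
  · simp [Matrix.mul_apply, Matrix.star_apply]

theorem exists_density {d : Finset QDomain} {J : Type} [Fintype J]
    {r : J → (QDomain → Fin 2) → ℂ} (hr : ∀ j, DependsOn (r j) d) {j₀ : J} (h : r j₀ ≠ 0) :
    ∃ ρ : Density d, Rep ρ.1 r := by
  let M : Op d := ∑ j, Matrix.vecMulVec (fun u => r j (patch u 0)) (star fun u => r j (patch u 0))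
  have hM : M.PosSemidef := Matrix.posSemidef_sum _ fun j _ =>
    Matrix.posSemidef_vecMulVec_self_star _
  have hx : ∀ j x, r j (patch (res d x) 0) = r j x := fun j x => hr j fun i hi => patch_mem _ _ hi
  have hM0 : M ≠ 0 := by
    intro h0
    refine h (funext fun x => ?_)
    have h1 : ∑ j, r j x * star (r j x) = 0 := by
      have := congrFun (congrFun h0 (res d x)) (res d x)
      simpa [M, Matrix.sum_apply, Matrix.vecMulVec_apply, hx] using this
    have h2 := (Finset.sum_eq_zero_iff_of_nonneg fun j _ => mul_star_self_nonneg (r j x)).1 h1 j₀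
      (Finset.mem_univ _)
    simpa using h2
  have ht : M.trace ≠ 0 := fun h0 => hM0 (hM.trace_eq_zero_iff.1 h0)
  refine ⟨⟨M.trace⁻¹ • M, hM.smul ?_, ?_⟩, hr, M.trace⁻¹, inv_ne_zero ht, fun x y => ?_⟩
  · exact (RCLike.inv_pos_of_pos (hM.trace_nonneg.lt_of_ne ht.symm)).le
  · rw [Matrix.trace_smul, smul_eq_mul, inv_mul_cancel₀ ht]
  · simp [M, Matrix.sum_apply, Matrix.vecMulVec_apply, hx]

theorem Rep.eq_zero_of_forall {d : Finset QDomain} {J : Type} [Fintype J] {ρ : Op d}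
    {r : J → (QDomain → Fin 2) → ℂ} (h : Rep ρ r) (hr : ∀ j, r j = 0) : ρ = 0 := by
  obtain ⟨-, c, -, hc⟩ := h
  ext u v
  have h1 := hc (patch u 0) (patch v 0)
  rw [res_patch, res_patch] at h1
  simpa [hr] using h1

theorem Density.ne_zero {d : Finset QDomain} (ρ : Density d) : ρ.1 ≠ 0 := fun h => by
  have := ρ.2.2
  rw [h, Matrix.trace_zero] at this
  exact zero_ne_one this

/-- The embedding of a list of qubit names into the set of all names. -/
def nameEmb {n : ℕ} (v : Fin n ↪ QName) : Fin n ↪ QDomain :=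
  v.trans Function.Embedding.inl

theorem extend_place_res {n : ℕ} (v : Fin n ↪ QName) {d : Finset QDomain}
    (h : ∀ i, Sum.inl (v i) ∈ d) (u : Fin n → Fin 2) (x : QDomain → Fin 2) :
    Function.extend (place v h) u (res d x) = res d (Function.extend (nameEmb v) u x) := by
  funext i
  by_cases hi : ∃ a, place v h a = i
  · obtain ⟨a, rfl⟩ := hi
    rw [(place v h).injective.extend_apply]
    exact ((nameEmb v).injective.extend_apply u x a).symm
  · rw [Function.extend_apply' _ _ _ hi]
    refine (Function.extend_apply' (f := nameEmb v) _ _ i.1 ?_).symm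
    rintro ⟨a, ha⟩
    exact hi ⟨a, Subtype.ext ha⟩

theorem Rep.basic {d : Finset QDomain} {J B : Type} [Fintype J] [Fintype B] {ρ ρ' : Op d}
    {r : J → (QDomain → Fin 2) → ℂ} (hr : Rep ρ r) {n : ℕ} {v : Fin n ↪ QName}
    (h : ∀ i, Sum.inl (v i) ∈ d) (K : B → Op (Fin n)) {c : ℂ} (hc : c ≠ 0)
    (hρ' : ρ' = c • liftOp (place v h) (∑ b, conjOp (K b)) ρ) :
    Rep ρ' (fun j : B × J => act (nameEmb v) (K j.1) (r j.2)) := by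
  obtain ⟨hd, c₀, hc₀, hρ⟩ := hr
  refine ⟨fun j => dependsOn_act _ (fun i => h i) _ (hd j.2), c * c₀, mul_ne_zero hc hc₀,
    fun x y => ?_⟩
  have key : ∀ b, liftOp (place v h) (conjOp (K b)) ρ (res d x) (res d y) =
      c₀ * ∑ j, act (nameEmb v) (K b) (r j) x * star (act (nameEmb v) (K b) (r j) y) := by
    intro b
    have e : ∀ x : QDomain → Fin 2, res d x ∘ place v h = x ∘ nameEmb v := fun _ => rfl
    rw [conjOp_eq_sand]
    simp only [liftOp, LinearMap.coe_mk, AddHom.coe_mk, Matrix.of_apply, sand_apply, e,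
      extend_place_res, hρ, Matrix.mulVec, dotProduct, act, star_sum, star_mul', star_star,
      Finset.mul_sum, Finset.sum_mul]
    rw [Finset.sum_comm_cycle]
    refine Finset.sum_congr rfl fun _ _ => ?_
    rw [Finset.sum_comm]
    refine Finset.sum_congr rfl fun _ _ => Finset.sum_congr rfl fun _ _ => ?_
    ring
  rw [hρ', liftOp_sum, LinearMap.sum_apply, Matrix.smul_apply, Matrix.sum_apply]
  simp only [key, Fintype.sum_prod_type, smul_eq_mul, ← Finset.mul_sum, mul_assoc]

/-! ### Partial traces and renaming -/

theorem posSemidef_restrict {d : Finset QDomain} {A : Op d} (hA : A.PosSemidef)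
    (a : Finset QDomain) : (restrict A a).PosSemidef := by
  have : restrict A a = ∑ z : ↥(d \ a) → Fin 2, A.submatrix (fun x => glue x z)
      fun x => glue x z := by
    ext x y
    simp [restrict, Matrix.sum_apply]
  rw [this]
  exact Matrix.posSemidef_sum _ fun z _ => hA.submatrix _

theorem trace_restrict {d a : Finset QDomain} (ha : a ⊆ d) (A : Op d) :
    (restrict A a).trace = A.trace := by
  simp only [Matrix.trace, Matrix.diag_apply, restrict, Matrix.of_apply]
  rw [← Fintype.sum_prod_type']
  refine Finset.sum_bij' (fun t _ => glue t.1 t.2)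
    (fun x _ => (fun i => x ⟨i.1, ha i.2⟩, fun i => x ⟨i.1, (Finset.mem_sdiff.1 i.2).1⟩))
    (fun _ _ => Finset.mem_univ _) (fun _ _ => Finset.mem_univ _) ?_ ?_ (fun _ _ => rfl)
  · rintro ⟨x, z⟩ _
    refine Prod.ext (funext fun i => ?_) (funext fun i => ?_)
    · simp [glue]
    · have := (Finset.mem_sdiff.1 i.2).2
      simp [glue, this]
  · intro x _
    funext i
    simp [glue]

theorem restrict_apply_res {d a : Finset QDomain} {p : QDomain} (hd : d = insert p a)
    (hp : p ∉ a) (A : Op d) (x y : QDomain → Fin 2) :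
    restrict A a (res a x) (res a y) =
      ∑ b, A (res d (Function.update x p b)) (res d (Function.update y p b)) := by
  subst hd
  simp only [restrict, Matrix.of_apply]
  have hmem : ∀ i : ↥(insert p a \ a), i.1 = p := fun i => by
    have := Finset.mem_sdiff.1 i.2
    exact (Finset.mem_insert.1 this.1).resolve_right this.2
  have hp' : p ∈ insert p a \ a := by simp [hp]
  refine Finset.sum_bij' (fun z _ => z ⟨p, hp'⟩) (fun b _ => fun _ => b)
    (fun _ _ => Finset.mem_univ _) (fun _ _ => Finset.mem_univ _) ?_ ?_ ?_
  · intro z _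
    funext i
    exact congrArg z (Subtype.ext (hmem i).symm)
  · intro b _
    rfl
  · intro z _
    have : ∀ x : QDomain → Fin 2, glue (res a x) z =
        res (insert p a) (Function.update x p (z ⟨p, hp'⟩)) := by
      intro x
      funext i
      unfold glue res
      split_ifs with hi
      · rw [Function.update_of_ne]
        rintro h
        exact hp (h ▸ hi)
      · have : i.1 = p := (Finset.mem_insert.1 i.2).resolve_right hi
        refine (congrArg z (Subtype.ext this)).trans (?_ : z ⟨p, hp'⟩ = _)
        rw [this, Function.update_self]
    rw [this, this]

theorem rename_apply_res (q : QName) (s : ℕ) {d : Finset QDomain} (A : Op d)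
    (x y : QDomain → Fin 2) :
    rename q s A (res _ x) (res _ y) =
      A (res d (x ∘ Equiv.swap (Sum.inl q) (Sum.inr s)))
        (res d (y ∘ Equiv.swap (Sum.inl q) (Sum.inr s))) := rfl

theorem mem_renameDom {q : QName} {s : ℕ} {d : Finset QDomain} {i : QDomain} :
    i ∈ renameDom q s d ↔ Equiv.swap (Sum.inl q) (Sum.inr s) i ∈ d := by
  rw [renameDom, Finset.mem_map_equiv, Equiv.symm_swap]

theorem inl_notMem_renameDom {q : QName} {s : ℕ} {d : Finset QDomain} (hs : Sum.inr s ∉ d) :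
    Sum.inl q ∉ renameDom q s d := by
  rwa [mem_renameDom, Equiv.swap_apply_left]

theorem trace_rename (q : QName) (s : ℕ) {d : Finset QDomain} (A : Op d) :
    (rename q s A).trace = A.trace := by
  simp only [Matrix.trace, Matrix.diag_apply, rename, Matrix.of_apply]
  have hm : ∀ i : QDomain, i ∈ d ↔ Equiv.swap (Sum.inl q) (Sum.inr s) i ∈ renameDom q s d :=
    fun i => by rw [mem_renameDom, Equiv.swap_apply_self]
  exact Equiv.sum_comp ((Equiv.arrowCongr ((Equiv.swap (Sum.inl q) (Sum.inr s)).subtypeEquiv hm)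
    (Equiv.refl (Fin 2))).symm) fun x => A x x

theorem Rep.free {d : Finset QDomain} {J : Type} [Fintype J] {ρ : Op d}
    {r : J → (QDomain → Fin 2) → ℂ} (hr : Rep ρ r) {p : QDomain} (hp : p ∈ d) :
    Rep (restrict ρ (d \ {p})) (fun (j : J × Fin 2) x => r j.1 (Function.update x p j.2)) := by
  obtain ⟨hd, c, hc, hρ⟩ := hr
  refine ⟨fun j x y hxy => hd j.1 fun i hi => ?_, c, hc, fun x y => ?_⟩
  · by_cases hip : i = p
    · subst hip; simp
    · rw [Function.update_of_ne hip, Function.update_of_ne hip]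
      exact hxy i (by simp_all)
  · rw [restrict_apply_res (p := p) (by rw [Finset.sdiff_singleton_eq_erase,
      Finset.insert_erase hp]) (by simp)]
    simp only [hρ, ← Finset.mul_sum]
    rw [Fintype.sum_prod_type, Finset.sum_comm]

/-- The allocation of `p` with the new qubit in the completely mixed state is a legitimate one. -/
theorem exists_alloc {d : Finset QDomain} {J : Type} [Fintype J] (ρ : Density d)
    {r : J → (QDomain → Fin 2) → ℂ} (hr : Rep ρ.1 r) (p : QName) {s : ℕ}
    (hs : Sum.inr s ∉ d) :
    ∃ ρ' : Density (insert (Sum.inl p) (renameDom p s d)),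
      restrict ρ'.1 (renameDom p s d) = rename p s ρ.1 ∧
        Rep ρ'.1 (allocFamily (Sum.inl p) (Sum.inr s) r) := by
  obtain ⟨hd, c, hc, hρ⟩ := hr
  let a := renameDom p s d
  have hpa : Sum.inl p ∉ a := inl_notMem_renameDom hs
  let P : ↥(insert (Sum.inl p) a) := ⟨Sum.inl p, Finset.mem_insert_self _ _⟩
  let f : (↥(insert (Sum.inl p) a) → Fin 2) → (a → Fin 2) :=
    fun x i => x ⟨i.1, Finset.mem_insert_of_mem i.2⟩
  let M : Op ↥(insert (Sum.inl p) a) :=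
    (2⁻¹ : ℂ) • ((1 : Matrix (Fin 2) (Fin 2) ℂ).submatrix (fun x => x P) fun x => x P).hadamard
      ((rename p s ρ.1).submatrix f f)
  have hren : (rename p s ρ.1).PosSemidef := ρ.2.1.submatrix _
  have hM : M.PosSemidef :=
    (((Matrix.PosSemidef.one).submatrix _).hadamard (hren.submatrix _)).smul
      (by rw [Complex.le_def]; norm_num)
  have hMx : ∀ x y : QDomain → Fin 2, M (res _ x) (res _ y) =
      2⁻¹ * ((if x (Sum.inl p) = y (Sum.inl p) then 1 else 0) *
        rename p s ρ.1 (res a x) (res a y)) := by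
    intro x y
    simp only [M, Matrix.smul_apply, Matrix.hadamard_apply, Matrix.submatrix_apply,
      Matrix.one_apply, smul_eq_mul]
    rfl
  have hres : restrict M a = rename p s ρ.1 := by
    ext u v
    rw [← res_patch u 0, ← res_patch v 0, restrict_apply_res rfl hpa]
    have : ∀ (x : QDomain → Fin 2) (b : Fin 2),
        res a (Function.update x (Sum.inl p) b) = res a x := fun x b =>
      funext fun i => Function.update_of_ne (fun h : i.1 = Sum.inl p => hpa (h ▸ i.2)) _ _
    simp only [hMx, this, Function.update_self]
    simp
  refine ⟨⟨M, hM, ?_⟩, hres, fun j x y hxy => ?_, 2⁻¹ * c,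
    mul_ne_zero (by norm_num) hc, fun x y => ?_⟩
  · rw [← trace_restrict (Finset.subset_insert (Sum.inl p) a) M, hres, trace_rename, ρ.2.2]
  · have h1 : x (Sum.inl p) = y (Sum.inl p) := hxy _ (Finset.mem_insert_self _ _)
    have h2 : r j.1 (x ∘ Equiv.swap (Sum.inl p) (Sum.inr s)) =
        r j.1 (y ∘ Equiv.swap (Sum.inl p) (Sum.inr s)) := hd j.1 fun i hi =>
      hxy _ (Finset.mem_insert_of_mem (by
        rw [mem_renameDom, Equiv.swap_apply_self]; exact hi))
    simp only [allocFamily, h1, h2]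
  · refine (hMx x y).trans ?_
    simp only [a, rename_apply_res, hρ, allocFamily, Fintype.sum_prod_type, Fin.sum_univ_two]
    rw [mul_assoc]
    congr 1
    rw [mul_left_comm, Finset.mul_sum]
    congr 1
    refine Finset.sum_congr rfl fun j _ => ?_
    generalize x (Sum.inl p) = b
    generalize y (Sum.inl p) = b'
    fin_cases b <;> fin_cases b' <;> simp

/-- A functional of coordinates in `m` that kills a heap kills every heap obtained from it by an
allocation, provided that `m` does not contain the new names. -/
theorem kills_of_restrict_eq {d : Finset QDomain} {J J' : Type} [Fintype J] [Fintype J']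
    {ρ : Op d} {r : J → (QDomain → Fin 2) → ℂ} (hr : Rep ρ r) {p : QName} {s : ℕ}
    (hs : Sum.inr s ∉ d) {ρ' : Op ↥(insert (Sum.inl p) (renameDom p s d))}
    {r' : J' → (QDomain → Fin 2) → ℂ} (hr' : Rep ρ' r')
    (h : restrict ρ' (renameDom p s d) = rename p s ρ) {m : Finset QDomain}
    (hp : Sum.inl p ∉ m) (hsm : Sum.inr s ∉ m) {w : (QDomain → Fin 2) → ℂ} (hw : DependsOn w m)
    (hk : ∀ j, Kills m w (r j)) (j : J') : Kills m w (r' j) := by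
  obtain ⟨-, c, -, hρ⟩ := hr
  obtain ⟨-, c', hc', hρ'⟩ := hr'
  have hpa : Sum.inl p ∉ renameDom p s d := inl_notMem_renameDom hs
  intro x
  set σ := Equiv.swap (Sum.inl p : QDomain) (Sum.inr s) with hσ
  have hzero : ∀ j, ∑ y ∈ box m x, w y * r j (y ∘ σ) = 0 := by
    intro j
    rw [← hk j (x ∘ σ), sum_box, sum_box]
    refine Finset.sum_congr rfl fun u _ => ?_
    have hfix : ∀ i ∈ m, σ i = i := fun i hi =>
      Equiv.swap_apply_of_ne_of_ne (fun h => hp (h ▸ hi)) (fun h => hsm (h ▸ hi))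
    congr 1
    · exact hw fun i hi => by rw [patch_mem _ _ hi, patch_mem _ _ hi]
    · congr 1
      funext i
      rw [Function.comp_apply]
      by_cases hi : i ∈ m
      · rw [hfix i hi, patch_mem _ _ hi, patch_mem _ _ hi]
      · have : σ i ∉ m := fun h' => hi (by
          have := hfix _ h'
          rwa [σ.injective this] at h')
        rw [patch_notMem _ _ hi, patch_notMem _ _ this, Function.comp_apply]
  have hrest : ∀ y z, c' * ∑ b, ∑ j, r' j (Function.update y (Sum.inl p) b) *
      star (r' j (Function.update z (Sum.inl p) b)) =
        c * ∑ j, r j (y ∘ σ) * star (r j (z ∘ σ)) := by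
    intro y z
    have h1 := congrFun (congrFun h (res _ y)) (res _ z)
    rw [restrict_apply_res rfl hpa, rename_apply_res, hρ] at h1
    simp only [hρ', ← Finset.mul_sum] at h1
    exact h1
  -- the functional evaluates the partial trace of `ρ'` to the sum of the `|g j b|²`, and it
  -- evaluates the renamed `ρ` to zero
  let g : J' → Fin 2 → ℂ := fun j b => ∑ y ∈ box m x, w y * r' j (Function.update y (Sum.inl p) b)
  have hg : ∑ b, ∑ j, g j b * star (g j b) = 0 := by
    have h1 : c' * ∑ b, ∑ j, g j b * star (g j b) =
        ∑ y ∈ box m x, ∑ z ∈ box m x, w y * star (w z) *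
          (c' * ∑ b, ∑ j, r' j (Function.update y (Sum.inl p) b) *
      star (r' j (Function.update z (Sum.inl p) b))) := by
      simp only [g, star_sum, star_mul', Finset.sum_mul_sum]
      simp only [Finset.mul_sum]
      have e1 : ∀ b : Fin 2, ∑ j, ∑ y ∈ box m x, ∑ z ∈ box m x, c' *
            (w y * r' j (Function.update y (Sum.inl p) b) *
              (star (w z) * star (r' j (Function.update z (Sum.inl p) b)))) =
          ∑ y ∈ box m x, ∑ z ∈ box m x, ∑ j, c' *
            (w y * r' j (Function.update y (Sum.inl p) b) *
              (star (w z) * star (r' j (Function.update z (Sum.inl p) b)))) := fun b => by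
        rw [Finset.sum_comm]
        exact Finset.sum_congr rfl fun y _ => Finset.sum_comm
      simp only [e1]
      rw [Finset.sum_comm]
      refine Finset.sum_congr rfl fun y _ => ?_
      rw [Finset.sum_comm]
      refine Finset.sum_congr rfl fun z _ => Finset.sum_congr rfl fun b _ =>
        Finset.sum_congr rfl fun j _ => ?_
      ring
    have h2 : ∑ y ∈ box m x, ∑ z ∈ box m x, w y * star (w z) *
        (c * ∑ j, r j (y ∘ σ) * star (r j (z ∘ σ))) =
        c * ∑ j, (∑ y ∈ box m x, w y * r j (y ∘ σ)) *
          star (∑ y ∈ box m x, w y * r j (y ∘ σ)) := by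
      simp only [star_sum, star_mul', Finset.sum_mul_sum]
      simp only [Finset.mul_sum]
      symm
      rw [Finset.sum_comm]
      refine Finset.sum_congr rfl fun y _ => ?_
      rw [Finset.sum_comm]
      refine Finset.sum_congr rfl fun z _ => Finset.sum_congr rfl fun j _ => ?_
      ring
    simp only [hrest] at h1
    rw [h2] at h1
    simp only [hzero, zero_mul, Finset.sum_const_zero, mul_zero] at h1
    exact (mul_eq_zero.1 h1).resolve_left hc'
  have h3 := (Finset.sum_eq_zero_iff_of_nonneg fun b _ =>
    Finset.sum_nonneg fun j _ => mul_star_self_nonneg (g j b)).1 hg (x (Sum.inl p))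
      (Finset.mem_univ _)
  have h4 := (Finset.sum_eq_zero_iff_of_nonneg fun j _ => mul_star_self_nonneg (g j _)).1 h3 j
      (Finset.mem_univ _)
  have h5 : g j (x (Sum.inl p)) = 0 := by simpa using h4
  rw [← h5]
  refine Finset.sum_congr rfl fun y hy => ?_
  rw [← mem_box.1 hy _ hp, Function.update_eq_self]

theorem Rep.ne_zero {d : Finset QDomain} {J : Type} [Fintype J] {ρ : Op d}
    {r : J → (QDomain → Fin 2) → ℂ} (h : Rep ρ r) {j : J} (hj : r j ≠ 0) : ρ ≠ 0 := by
  obtain ⟨-, c, hc, hρ⟩ := h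
  rintro rfl
  refine hj (funext fun x => ?_)
  have h1 := hρ x x
  rw [Matrix.zero_apply, eq_comm, mul_eq_zero, or_iff_right hc] at h1
  have h2 := (Finset.sum_eq_zero_iff_of_nonneg fun j _ => mul_star_self_nonneg (r j x)).1 h1 j
      (Finset.mem_univ _)
  simpa using h2

theorem exists_density_smul {d : Finset QDomain} {M : Op d} (hM : M.PosSemidef)
    (ht : M.trace ≠ 0) : ∃ ρ : Density d, ρ.1 = M.trace⁻¹ • M :=
  ⟨⟨M.trace⁻¹ • M, hM.smul (RCLike.inv_pos_of_pos (hM.trace_nonneg.lt_of_ne ht.symm)).le,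
    by rw [Matrix.trace_smul, smul_eq_mul, inv_mul_cancel₀ ht]⟩, rfl⟩

/-! ### Labelled steps -/

/-- The qubit names that have to be present when an operation is applied. -/
def PathOp.need : PathOp → Set QName
  | .basic v _ => Set.range v
  | .alloc _ => ∅
  | .free q => {q}

/-- `Head S o S'`: the first step of `S` may apply the operation `o` and leave the program `S'`.
This is the part of a step that depends neither on the state nor on its domain. -/
inductive Head : Stmt → PathOp → Option Stmt → Prop
  | skip : Head .skip (.basic (n := 0) Function.Embedding.ofIsEmpty LinearMap.id) none
  | init {n : ℕ} {v : Fin n ↪ QName} : Head (.init v) (.basic v (initOp n)) none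
  | unitary {n : ℕ} {v : Fin n ↪ QName} {U : Matrix.unitaryGroup (Fin n → Fin 2) ℂ} :
      Head (.unitary v U) (.basic v (conjOp U.1)) none
  | qalloc {q : QName} : Head (.qalloc q) (.alloc q) none
  | qfree {q : QName} : Head (.qfree q) (.free q) none
  | seq_step {S₁ S₁' S₂ : Stmt} {o : PathOp} (h : Head S₁ o (some S₁')) :
      Head (.seq S₁ S₂) o (some (.seq S₁' S₂))
  | seq_done {S₁ S₂ : Stmt} {o : PathOp} (h : Head S₁ o none) : Head (.seq S₁ S₂) o (some S₂)
  | ifm {n k : ℕ} {v : Fin n ↪ QName} {M : Measurement n k} {S : Fin k → Stmt} (m : Fin k) :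
      Head (.ifm v M S) (.basic v (conjOp (M.P m))) (some (S m))
  | while_done {n : ℕ} {v : Fin n ↪ QName} {M : Measurement n 2} {S : Stmt} :
      Head (.while v M S) (.basic v (conjOp (M.P 0))) none
  | while_loop {n : ℕ} {v : Fin n ↪ QName} {M : Measurement n 2} {S : Stmt} :
      Head (.while v M S) (.basic v (conjOp (M.P 1))) (some (.seq S (.while v M S)))

/-- The effect of an operation on a heap.  The output of a basic operation is normalized, which
changes nothing unless the operation comes from a measurement. -/
inductive Effect : PathOp → QHeap → QHeap → Prop
  | basic {n : ℕ} {v : Fin n ↪ QName} {E : SuperOp (Fin n)} {d : Finset QDomain}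
      (h : ∀ i, Sum.inl (v i) ∈ d) (ρ ρ' : Density d)
      (hm : (liftOp (place v h) E ρ.1).trace ≠ 0)
      (hρ : ρ'.1 = (liftOp (place v h) E ρ.1).trace⁻¹ • liftOp (place v h) E ρ.1) :
      Effect (.basic v E) ⟨d, ρ⟩ ⟨d, ρ'⟩
  | alloc {q : QName} {d : Finset QDomain} (ρ : Density d) (s : ℕ) (hs : Sum.inr s ∉ d)
      (ρ' : Density (insert (Sum.inl q) (renameDom q s d)))
      (hρ : restrict ρ'.1 (renameDom q s d) = rename q s ρ.1) :
      Effect (.alloc q) ⟨d, ρ⟩ ⟨insert (Sum.inl q) (renameDom q s d), ρ'⟩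
  | free {q : QName} {d : Finset QDomain} (h : Sum.inl q ∈ d) (ρ : Density d)
      (ρ' : Density (d \ {Sum.inl q})) (hρ : ρ'.1 = restrict ρ.1 (d \ {Sum.inl q})) :
      Effect (.free q) ⟨d, ρ⟩ ⟨d \ {Sum.inl q}, ρ'⟩

/-- The effect of an operation on a domain. -/
inductive DomEffect : PathOp → Finset QDomain → Finset QDomain → Prop
  | basic {n : ℕ} {v : Fin n ↪ QName} {E : SuperOp (Fin n)} {d : Finset QDomain}
      (h : ∀ i, Sum.inl (v i) ∈ d) : DomEffect (.basic v E) d d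
  | alloc {q : QName} {d : Finset QDomain} (s : ℕ) (hs : Sum.inr s ∉ d) :
      DomEffect (.alloc q) d (insert (Sum.inl q) (renameDom q s d))
  | free {q : QName} {d : Finset QDomain} (h : Sum.inl q ∈ d) :
      DomEffect (.free q) d (d \ {Sum.inl q})

theorem trace_initOp (n : ℕ) (A : Op (Fin n)) : (initOp n A).trace = A.trace := by
  rw [initOp, LinearMap.sum_apply, Matrix.trace_sum,
    trace_sum_conjOp (sum_single_conjTranspose_mul n)]

theorem trace_conjOp_unitary {n : ℕ} (U : Matrix.unitaryGroup (Fin n → Fin 2) ℂ)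
    (A : Op (Fin n)) : (conjOp U.1 A).trace = A.trace := by
  have h := trace_sum_conjOp (J := Unit) (K := fun _ => U.1)
    ((Fintype.sum_unique _).trans (Matrix.mem_unitaryGroup_iff'.1 U.2)) A
  simpa using h

theorem PathStep.head {S : Stmt} {S' : Option Stmt} {d d' : Finset QDomain} {o : PathOp}
    (h : PathStep S d o S' d') : Head S o S' ∧ DomEffect o d d' := by
  induction h with
  | skip d => exact ⟨.skip, .basic fun i => i.elim0⟩
  | init h => exact ⟨.init, .basic h⟩
  | unitary h => exact ⟨.unitary, .basic h⟩
  | qalloc s hs => exact ⟨.qalloc, .alloc s hs⟩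
  | qfree h => exact ⟨.qfree, .free h⟩
  | seq_step _ ih => exact ⟨.seq_step ih.1, ih.2⟩
  | seq_done _ ih => exact ⟨.seq_done ih.1, ih.2⟩
  | ifm h m => exact ⟨.ifm m, .basic h⟩
  | while_done h => exact ⟨.while_done, .basic h⟩
  | while_loop h => exact ⟨.while_loop, .basic h⟩

theorem Effect.basic_of_trace {n : ℕ} {v : Fin n ↪ QName} {E : SuperOp (Fin n)}
    {d : Finset QDomain} (h : ∀ i, Sum.inl (v i) ∈ d) (ρ ρ' : Density d)
    (hρ : ρ'.1 = liftOp (place v h) E ρ.1) : Effect (.basic v E) ⟨d, ρ⟩ ⟨d, ρ'⟩ := by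
  have ht : (liftOp (place v h) E ρ.1).trace = 1 := by rw [← hρ, ρ'.2.2]
  exact .basic h ρ ρ' (by rw [ht]; exact one_ne_zero) (by rw [ht, inv_one, one_smul, hρ])

theorem Step.head {S : Stmt} {S' : Option Stmt} {ρ ρ' : QHeap}
    (h : Step (some S, ρ) (S', ρ')) : ∃ o, Head S o S' ∧ Effect o ρ ρ' := by
  generalize hc : ((some S, ρ) : Config) = c at h
  generalize hc' : ((S', ρ') : Config) = c' at h
  induction h generalizing S S' ρ ρ' with
  | skip ρ =>
    cases hc; cases hc'
    exact ⟨_, .skip, .basic_of_trace (fun i => i.elim0) _ _ (by rw [liftOp_id]; rfl)⟩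
  | init h ρ ρ' hρ => cases hc; cases hc'; exact ⟨_, .init, .basic_of_trace h _ _ hρ⟩
  | unitary h ρ ρ' hρ => cases hc; cases hc'; exact ⟨_, .unitary, .basic_of_trace h _ _ hρ⟩
  | qalloc ρ s hs ρ' hρ => cases hc; cases hc'; exact ⟨_, .qalloc, .alloc _ s hs _ hρ⟩
  | qfree h ρ ρ' hρ => cases hc; cases hc'; exact ⟨_, .qfree, .free h _ _ hρ⟩
  | seq_step _ ih =>
    cases hc; cases hc'
    obtain ⟨o, h1, h2⟩ := ih rfl rfl
    exact ⟨o, .seq_step h1, h2⟩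
  | seq_done _ ih =>
    cases hc; cases hc'
    obtain ⟨o, h1, h2⟩ := ih rfl rfl
    exact ⟨o, .seq_done h1, h2⟩
  | ifm h m ρ ρ' hm hρ => cases hc; cases hc'; exact ⟨_, .ifm m, .basic h _ _ hm hρ⟩
  | while_done h ρ ρ' hm hρ => cases hc; cases hc'; exact ⟨_, .while_done, .basic h _ _ hm hρ⟩
  | while_loop h ρ ρ' hm hρ => cases hc; cases hc'; exact ⟨_, .while_loop, .basic h _ _ hm hρ⟩

theorem Head.step {S : Stmt} {S' : Option Stmt} {o : PathOp} (h : Head S o S') {ρ ρ' : QHeap}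
    (he : Effect o ρ ρ') : Step (some S, ρ) (S', ρ') := by
  induction h with
  | skip =>
    cases he with
    | basic h ρ ρ' hm hρ =>
      have : ρ' = ρ := Subtype.ext (by
        rw [hρ, liftOp_id, LinearMap.id_apply, ρ.2.2, inv_one, one_smul])
      subst this
      exact .skip _
  | init =>
    cases he with
    | basic h ρ ρ' hm hρ =>
      rw [trace_liftOp (trace_initOp _), ρ.2.2, inv_one, one_smul] at hρ
      exact .init h ρ ρ' hρ
  | unitary =>
    cases he with
    | basic h ρ ρ' hm hρ =>
      rw [trace_liftOp (trace_conjOp_unitary _), ρ.2.2, inv_one, one_smul] at hρ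
      exact .unitary h ρ ρ' hρ
  | qalloc => cases he with | alloc ρ s hs ρ' hρ => exact .qalloc ρ s hs ρ' hρ
  | qfree => cases he with | free h ρ ρ' hρ => exact .qfree h ρ ρ' hρ
  | seq_step _ ih => exact .seq_step (ih he)
  | seq_done _ ih => exact .seq_done (ih he)
  | ifm m => cases he with | basic h ρ ρ' hm hρ => exact .ifm h m ρ ρ' hm hρ
  | while_done => cases he with | basic h ρ ρ' hm hρ => exact .while_done h ρ ρ' hm hρ
  | while_loop => cases he with | basic h ρ ρ' hm hρ => exact .while_loop h ρ ρ' hm hρ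

/-- All operations that a program may apply first need the same qubits. -/
theorem Head.need_eq {S : Stmt} {S' S'' : Option Stmt} {o o' : PathOp} (h : Head S o S')
    (h' : Head S o' S'') : o.need = o'.need := by
  induction h generalizing o' S'' with
  | seq_step _ ih => cases h' with
    | seq_step h => exact ih h
    | seq_done h => exact ih h
  | seq_done _ ih => cases h' with
    | seq_step h => exact ih h
    | seq_done h => exact ih h
  | _ => cases h' <;> rfl

/-- A basic operation of a program has Kraus operators and is a quantum operation. -/
def PathOp.IsKraus : PathOp → Prop
  | .basic (n := n) _ E => ∃ (B : Type) (_ : Fintype B) (K : B → Op (Fin n)),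
      E = ∑ b, conjOp (K b) ∧ IsQuantumOp E
  | _ => True

theorem Head.isKraus {S : Stmt} {S' : Option Stmt} {o : PathOp} (h : Head S o S') :
    o.IsKraus := by
  induction h with
  | skip =>
    refine ⟨Unit, inferInstance, fun _ => 1, ?_, isQuantumOp_id⟩
    ext1 A
    simp [conjOp]
  | init =>
    exact ⟨_, inferInstance, _, rfl, isQuantumOp_sum_conjOp (sum_single_conjTranspose_mul _)⟩
  | @unitary n v U =>
    refine ⟨Unit, inferInstance, fun _ => U.1, by simp, ?_⟩
    exact isQuantumOp_conjOp (K := fun _ : Unit => U.1)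
      ((Fintype.sum_unique _).trans (Matrix.mem_unitaryGroup_iff'.1 U.2)) ()
  | qalloc => trivial
  | qfree => trivial
  | seq_step _ ih => exact ih
  | seq_done _ ih => exact ih
  | @ifm n k v M S m =>
    exact ⟨Unit, inferInstance, fun _ => M.P m, by simp,
      isQuantumOp_conjOp M.sum_conjTranspose_mul m⟩
  | @while_done n v M S =>
    exact ⟨Unit, inferInstance, fun _ => M.P 0, by simp,
      isQuantumOp_conjOp M.sum_conjTranspose_mul 0⟩
  | @while_loop n v M S =>
    exact ⟨Unit, inferInstance, fun _ => M.P 1, by simp,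
      isQuantumOp_conjOp M.sum_conjTranspose_mul 1⟩

theorem DomEffect.need {o : PathOp} {d d' : Finset QDomain} (h : DomEffect o d d') :
    ∀ a ∈ o.need, Sum.inl a ∈ d := by
  cases h with
  | basic h => rintro _ ⟨i, rfl⟩; exact h i
  | alloc => rintro _ ⟨⟩
  | free h => rintro _ rfl; exact h

theorem Effect.domEffect {o : PathOp} {ρ ρ' : QHeap} (h : Effect o ρ ρ') :
    DomEffect o ρ.1 ρ'.1 := by
  cases h with
  | basic h => exact .basic h
  | alloc _ s hs => exact .alloc s hs
  | free h => exact .free h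

theorem exists_fresh (d : Finset QDomain) : ∃ s : ℕ, Sum.inr s ∉ d := by
  obtain ⟨s, hs⟩ := Infinite.exists_notMem_finset d.toRight
  exact ⟨s, by simpa using hs⟩

/-- Some outcome of a measurement has nonzero probability. -/
theorem Measurement.exists_trace_ne_zero {n k : ℕ} (M : Measurement n k) {d : Finset QDomain}
    (e : Fin n ↪ d) (ρ : Density d) : ∃ m, (liftOp e (conjOp (M.P m)) ρ.1).trace ≠ 0 := by
  by_contra! h
  have h1 : (liftOp e (∑ m, conjOp (M.P m)) ρ.1).trace = 1 := by
    rw [trace_liftOp (fun A => ?_), ρ.2.2]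
    rw [LinearMap.sum_apply, Matrix.trace_sum, trace_sum_conjOp M.sum_conjTranspose_mul]
  rw [liftOp_sum, LinearMap.sum_apply, Matrix.trace_sum] at h1
  simp [h] at h1

theorem exists_effect_of_isQuantumOp {n : ℕ} {v : Fin n ↪ QName} {E : SuperOp (Fin n)}
    (hE : IsQuantumOp E) {d : Finset QDomain} (h : ∀ i, Sum.inl (v i) ∈ d) (ρ : Density d)
    (ht : (liftOp (place v h) E ρ.1).trace ≠ 0) :
    ∃ ρ' : Density d, Effect (.basic v E) ⟨d, ρ⟩ ⟨d, ρ'⟩ ∧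
      ρ'.1 = (liftOp (place v h) E ρ.1).trace⁻¹ • liftOp (place v h) E ρ.1 := by
  obtain ⟨ρ', hρ'⟩ := exists_density_smul ((hE.liftOp (place v h)).1.posSemidef ρ.2.1) ht
  exact ⟨ρ', .basic h ρ ρ' ht hρ', hρ'⟩

theorem exists_free {d : Finset QDomain} (p : QName) (ρ : Density d) :
    ∃ ρ' : Density (d \ {Sum.inl p}), ρ'.1 = restrict ρ.1 (d \ {Sum.inl p}) :=
  ⟨⟨_, posSemidef_restrict ρ.2.1 _, by rw [trace_restrict Finset.sdiff_subset, ρ.2.2]⟩, rfl⟩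

/-- A program is not stuck on a heap that contains the qubits needed by its first step. -/
theorem Head.exists_step {S : Stmt} {S' : Option Stmt} {o : PathOp} (h : Head S o S')
    {ρ : QHeap} (hn : ∀ a ∈ o.need, Sum.inl a ∈ ρ.1) : ∃ c, Step (some S, ρ) c := by
  have hbasic : ∀ {n : ℕ} {v : Fin n ↪ QName} {E : SuperOp (Fin n)} {S S'},
      Head S (.basic v E) S' → ∀ h : ∀ i, Sum.inl (v i) ∈ ρ.1,
      (liftOp (place v h) E ρ.2.1).trace ≠ 0 → ∃ c, Step (some S, ρ) c := by
    intro n v E S S' hH h ht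
    obtain ⟨B, _, K, hK, hE⟩ := hH.isKraus
    obtain ⟨ρ', hρ', -⟩ := exists_effect_of_isQuantumOp hE h ρ.2 ht
    exact ⟨_, hH.step hρ'⟩
  induction h with
  | skip => exact ⟨_, .skip ρ⟩
  | init =>
    refine hbasic .init (fun i => hn _ ⟨i, rfl⟩) ?_
    rw [trace_liftOp (trace_initOp _), ρ.2.2.2]
    exact one_ne_zero
  | unitary =>
    refine hbasic .unitary (fun i => hn _ ⟨i, rfl⟩) ?_
    rw [trace_liftOp (trace_conjOp_unitary _), ρ.2.2.2]
    exact one_ne_zero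
  | @qalloc q =>
    obtain ⟨r, hr⟩ := exists_rep ρ.2.2.1
    obtain ⟨s, hs⟩ := exists_fresh ρ.1
    obtain ⟨ρ', hρ', -⟩ := exists_alloc ρ.2 hr q hs
    exact ⟨_, .qalloc ρ.2 s hs ρ' hρ'⟩
  | qfree =>
    obtain ⟨ρ', hρ'⟩ := exists_free _ ρ.2
    exact ⟨_, .qfree (hn _ rfl) ρ.2 ρ' hρ'⟩
  | seq_step _ ih =>
    obtain ⟨⟨_ | S, ρ'⟩, hc⟩ := ih hn
    · exact ⟨_, .seq_done hc⟩
    · exact ⟨_, .seq_step hc⟩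
  | seq_done _ ih =>
    obtain ⟨⟨_ | S, ρ'⟩, hc⟩ := ih hn
    · exact ⟨_, .seq_done hc⟩
    · exact ⟨_, .seq_step hc⟩
  | @ifm n k v M S m =>
    have h : ∀ i, Sum.inl (v i) ∈ ρ.1 := fun i => hn _ ⟨i, rfl⟩
    obtain ⟨m, hm⟩ := M.exists_trace_ne_zero (place v h) ρ.2
    exact hbasic (.ifm m) h hm
  | @while_done n v M S =>
    have h : ∀ i, Sum.inl (v i) ∈ ρ.1 := fun i => hn _ ⟨i, rfl⟩
    obtain ⟨m, hm⟩ := M.exists_trace_ne_zero (place v h) ρ.2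
    obtain rfl | rfl : m = 0 ∨ m = 1 := by omega
    · exact hbasic .while_done h hm
    · exact hbasic .while_loop h hm
  | @while_loop n v M S =>
    have h : ∀ i, Sum.inl (v i) ∈ ρ.1 := fun i => hn _ ⟨i, rfl⟩
    obtain ⟨m, hm⟩ := M.exists_trace_ne_zero (place v h) ρ.2
    obtain rfl | rfl : m = 0 ∨ m = 1 := by omega
    · exact hbasic .while_done h hm
    · exact hbasic .while_loop h hm

/-! ### Named parts of domains -/

/-- The qubit names in a domain. -/
def nm (d : Finset QDomain) : Finset QDomain := nameDom d.toLeft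

@[simp] theorem inl_mem_nm {a : QName} {d : Finset QDomain} : Sum.inl a ∈ nm d ↔ Sum.inl a ∈ d := by
  simp [nm, nameDom]

@[simp] theorem inr_notMem_nm {s : ℕ} {d : Finset QDomain} : Sum.inr s ∉ nm d := by
  simp [nm, nameDom]

theorem nm_subset (d : Finset QDomain) : nm d ⊆ d := by
  rintro (a | s) h
  · exact inl_mem_nm.1 h
  · exact (inr_notMem_nm h).elim

theorem nm_alloc {d : Finset QDomain} {p : QName} {s : ℕ} :
    nm (insert (Sum.inl p) (renameDom p s d)) = insert (Sum.inl p) (nm d \ {Sum.inl p}) := by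
  ext (a | t)
  · by_cases h : a = p
    · simp [h]
    · have : Equiv.swap (Sum.inl p : QDomain) (Sum.inr s) (Sum.inl a) = Sum.inl a :=
        Equiv.swap_apply_of_ne_of_ne (by simpa using h) (by simp)
      simp [h, mem_renameDom, this]
  · simp

theorem nm_free {d : Finset QDomain} {p : QName} :
    nm (d \ {Sum.inl p}) = nm d \ {Sum.inl p} := by
  ext (a | t) <;> simp

/-! ### Simulation -/

/-- A basic operation whose Kraus operators do not all annihilate the family of a heap has positive
probability, and it acts on the family by its Kraus operators. -/
theorem Rep.exists_effect_basic {n : ℕ} {v : Fin n ↪ QName} {B J : Type} [Fintype B] [Fintype J]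
    {K : B → Op (Fin n)} (hE : IsQuantumOp (∑ b, conjOp (K b))) {d : Finset QDomain}
    (h : ∀ i, Sum.inl (v i) ∈ d) {ρ : Density d} {r : J → (QDomain → Fin 2) → ℂ} (hr : Rep ρ.1 r)
    {j : B × J} (hj : act (nameEmb v) (K j.1) (r j.2) ≠ 0) :
    ∃ ρ' : Density d, Effect (.basic v (∑ b, conjOp (K b))) ⟨d, ρ⟩ ⟨d, ρ'⟩ ∧
      Rep ρ'.1 (fun j : B × J => act (nameEmb v) (K j.1) (r j.2)) := by
  have hM := hr.basic h K one_ne_zero (one_smul _ _).symm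
  have ht : (liftOp (place v h) (∑ b, conjOp (K b)) ρ.1).trace ≠ 0 := fun h0 =>
    hM.ne_zero hj ((((hE.liftOp (place v h)).1.posSemidef ρ.2.1).trace_eq_zero_iff).1 h0)
  obtain ⟨ρ', he, hρ'⟩ := exists_effect_of_isQuantumOp hE h ρ ht
  exact ⟨ρ', he, hr.basic h K (inv_ne_zero ht) hρ'⟩

/-- The heap `ρ₁` has fewer names than `ρ₂`, and the state of these names in `ρ₂` is supported
by their state in `ρ₁`. -/
def Dominates (ρ₁ ρ₂ : QHeap) : Prop :=
  nm ρ₁.1 ⊆ nm ρ₂.1 ∧ ∃ (J : Type) (_ : Fintype J) (r : J → (QDomain → Fin 2) → ℂ)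
    (J' : Type) (_ : Fintype J') (t : J' → (QDomain → Fin 2) → ℂ),
    Rep ρ₁.2.1 r ∧ Rep ρ₂.2.1 t ∧ ∀ k, Covers (nm ρ₁.1) r (t k)

/-- A dominating heap can follow each step of the heap that it dominates. -/
theorem Dominates.effect {ρ₁ ρ₂ ρ₂' : QHeap} (hd : Dominates ρ₁ ρ₂) {o : PathOp} (ho : o.IsKraus)
    (he : Effect o ρ₂ ρ₂') (hn : ∀ a ∈ o.need, Sum.inl a ∈ ρ₁.1) :
    ∃ ρ₁', Effect o ρ₁ ρ₁' ∧ Dominates ρ₁' ρ₂' := by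
  obtain ⟨hnm, J, _, r, J', _, t, hr, ht, hc⟩ := hd
  obtain ⟨d₁, ρ₁⟩ := ρ₁
  cases he with
  | @basic n v E d h ρ ρ' hm hρ =>
    obtain ⟨B, _, K, rfl, hE⟩ := ho
    have h₁ : ∀ i, Sum.inl (v i) ∈ d₁ := fun i => hn _ ⟨i, rfl⟩
    have ht' := ht.basic h K (inv_ne_zero hm) hρ
    have hc' : ∀ k : B × J', Covers (nm d₁) (fun j : B × J => act (nameEmb v) (K j.1) (r j.2))
        (act (nameEmb v) (K k.1) (t k.2)) := fun k =>
      (hc k.2).act_inside _ (fun i => inl_mem_nm.2 (h₁ i)) K k.1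
    obtain ⟨j, hj⟩ : ∃ j : B × J, act (nameEmb v) (K j.1) (r j.2) ≠ 0 := by
      by_contra! h0
      exact Density.ne_zero ρ' (ht'.eq_zero_of_forall fun k => (hc' k).eq_zero h0)
    obtain ⟨ρ₁', he', hr'⟩ := Rep.exists_effect_basic hE h₁ hr hj
    exact ⟨_, he', hnm, _, inferInstance, _, _, inferInstance, _, hr', ht', hc'⟩
  | @alloc p d ρ s hs ρ' hρ =>
    obtain ⟨s₁, hs₁⟩ := exists_fresh d₁
    obtain ⟨ρ₁', hρ₁', hr'⟩ := exists_alloc ρ₁ hr p hs₁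
    obtain ⟨t', ht'⟩ := exists_rep ρ'.2.1
    refine ⟨_, .alloc ρ₁ s₁ hs₁ ρ₁' hρ₁', ?_, _, inferInstance, _, _, inferInstance, _, hr', ht',
      fun k => ?_⟩
    · simp only [nm_alloc]
      exact Finset.insert_subset_insert _ (Finset.sdiff_subset_sdiff hnm le_rfl)
    · simp only [nm_alloc]
      refine Covers.alloc (d := d₁) ?_ (by simp) hs₁
        (Finset.sdiff_subset.trans (nm_subset _)) (by simp) hr.1
      intro w hw hk
      exact kills_of_restrict_eq ht hs ht' hρ (by simp) (by simp) hw
        (fun k => ((hc k).mono Finset.sdiff_subset) w hw hk) k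
  | @free p d h ρ ρ' hρ =>
    obtain ⟨ρ₁', hρ₁'⟩ := exists_free p ρ₁
    refine ⟨_, .free (hn p rfl) ρ₁ ρ₁' hρ₁', ?_, _, inferInstance, _, _, inferInstance, _,
      hρ₁' ▸ hr.free (hn p rfl), hρ ▸ ht.free h, fun k => ?_⟩
    · simp only [nm_free]
      exact Finset.sdiff_subset_sdiff hnm le_rfl
    · simp only [nm_free]
      refine Covers.free (fun w hw hk => ?_) (by simp)
      exact ((hc k.1).mono Finset.sdiff_subset w hw hk).comp_update hw (by simp) k.2

theorem not_step_none {ρ : QHeap} {c : Config} : ¬Step (none, ρ) c := nofun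

/-- Safety on a heap implies safety on all heaps that it dominates. -/
theorem Dominates.safe {S : Stmt} {ρ₁ ρ₂ : QHeap} (hd : Dominates ρ₁ ρ₂) (hS : Safe S ρ₁) :
    Safe S ρ₂ := by
  have key : ∀ c, Relation.ReflTransGen Step (some S, ρ₂) c →
      ∃ ρ₁', Relation.ReflTransGen Step (some S, ρ₁) (c.1, ρ₁') ∧ Dominates ρ₁' c.2 := by
    intro c hc
    induction hc with
    | refl => exact ⟨ρ₁, .refl, hd⟩
    | @tail b c _ hbc ih =>
      obtain ⟨ρ₁', hrun, hd'⟩ := ih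
      obtain ⟨_ | S', ρ⟩ := b
      · exact (not_step_none hbc).elim
      obtain ⟨o, ho, he⟩ := hbc.head
      obtain ⟨c₁, hc₁⟩ := hS S' ρ₁' hrun
      obtain ⟨o', ho', he'⟩ := hc₁.head
      obtain ⟨ρ₁'', he'', hd''⟩ := hd'.effect ho.isKraus he
        (fun a ha => he'.domEffect.need a (by rwa [← ho.need_eq ho']))
      exact ⟨ρ₁'', hrun.tail (ho.step he''), hd''⟩
  intro S' ρ₂' hrun
  obtain ⟨ρ₁', hrun', hd'⟩ := key _ hrun
  obtain ⟨c₁, hc₁⟩ := hS S' ρ₁' hrun'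
  obtain ⟨o', ho', he'⟩ := hc₁.head
  exact ho'.exists_step fun a ha =>
    inl_mem_nm.1 (hd'.1 (inl_mem_nm.2 (he'.domEffect.need a ha)))

/-- The completely mixed heap dominates every heap with more names. -/
theorem exists_dominates {d : Finset QDomain} {ρ₂ : QHeap} (h : nm d ⊆ nm ρ₂.1) :
    ∃ ρ₁ : Density d, Dominates ⟨d, ρ₁⟩ ρ₂ := by
  let r : (d → Fin 2) → (QDomain → Fin 2) → ℂ := fun j x =>
    if ∀ i ∈ d, x i = patch j 0 i then 1 else 0
  have hdep : ∀ j, DependsOn (r j) (d : Set QDomain) := by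
    intro j x y hxy
    have : (∀ i ∈ d, x i = patch j 0 i) ↔ ∀ i ∈ d, y i = patch j 0 i :=
      forall₂_congr fun i hi => by rw [hxy i hi]
    simp only [r, this]
  have hne : r 0 ≠ 0 := by
    intro h0
    have := congrFun h0 (patch (n := d) 0 0)
    simp [r] at this
  obtain ⟨ρ₁, hρ₁⟩ := exists_density hdep hne
  obtain ⟨t, ht⟩ := exists_rep ρ₂.2.2.1
  refine ⟨ρ₁, h, _, inferInstance, _, _, inferInstance, _, hρ₁, ht, fun k => ?_⟩
  refine Covers.mono (nm_subset d) fun w _ hk => ?_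
  -- no nonzero functional kills all basis states
  have hw0 : w = 0 := by
    funext x
    have h1 := hk (res d x) x
    simp only [r, mul_ite, mul_one, mul_zero] at h1
    rw [sum_box_point] at h1
    rw [Pi.zero_apply, ← h1]
    congr 1
    funext i
    by_cases hi : i ∈ d
    · rw [Finset.piecewise_eq_of_mem _ _ _ hi, patch_mem _ _ hi]; rfl
    · rw [Finset.piecewise_eq_of_notMem _ _ _ hi]
  intro x
  simp [hw0]

/-! ### Assertions -/

theorem Assr.contains_sem_le {s : Finset QName} {P : Submodule ℂ (Ket (nameDom s))}
    {d : Finset QDomain} {B : Submodule ℂ (Ket d)}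
    (h : ∀ hs : nameDom s ⊆ d, ∀ v ∈ P, ∀ w : Ket ↥(d \ nameDom s),
      tensorKet hs Finset.sdiff_subset v w ∈ B) :
    (Assr.contains s P).sem d ≤ B := by
  refine iSup_le fun d' => iSup_le fun hd' => Submodule.span_le.2 ?_
  rintro _ ⟨v, hv, w, -, rfl⟩
  by_cases hs : nameDom s = d'
  · subst hs
    simp only [Assr.sem, dif_pos] at hv
    exact h hd' v hv w
  · simp only [Assr.sem, dif_neg hs, Submodule.mem_bot] at hv
    subst hv
    have : tensorKet hd' Finset.sdiff_subset (0 : Ket d') w = 0 := by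
      ext x
      simp [tensorKet]
    rw [this]
    exact B.zero_mem

theorem Assr.tensorKet_mem_contains {s : Finset QName} {P : Submodule ℂ (Ket (nameDom s))}
    {d : Finset QDomain} (hs : nameDom s ⊆ d) {v : Ket (nameDom s)} (hv : v ∈ P)
    (w : Ket ↥(d \ nameDom s)) :
    tensorKet hs Finset.sdiff_subset v w ∈ (Assr.contains s P).sem d := by
  refine Submodule.mem_iSup_of_mem (nameDom s) (Submodule.mem_iSup_of_mem hs ?_)
  refine Submodule.subset_span ⟨v, ?_, w, ?_, rfl⟩
  · simpa only [Assr.sem, dif_pos] using hv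
  · trivial

theorem glue_comp_incl {a d : Finset QDomain} (h : a ⊆ d) (x : d → Fin 2) :
    glue (x ∘ incl h) (x ∘ incl Finset.sdiff_subset) = x := by
  funext i
  unfold glue
  split_ifs <;> rfl

theorem Assr.contains_top_sem {s : Finset QName} {d : Finset QDomain} (hs : nameDom s ⊆ d) :
    (Assr.contains s ⊤).sem d = ⊤ := by
  refine eq_top_iff.2 fun v _ => ?_
  have : v = ∑ a : nameDom s → Fin 2, tensorKet hs Finset.sdiff_subset
      (EuclideanSpace.single a (1 : ℂ)) (WithLp.toLp 2 fun z => v (glue a z)) := by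
    ext x
    rw [WithLp.ofLp_sum, Finset.sum_apply, Finset.sum_eq_single (x ∘ incl hs)]
    · simp [tensorKet, glue_comp_incl]
    · intro a _ ha
      simp [tensorKet, ha.symm]
    · simp
  rw [this]
  exact Submodule.sum_mem _ fun a _ => tensorKet_mem_contains hs Submodule.mem_top _

/-! ### Supports -/

/-- The vector over the domain `d` given by a function of labels. -/
def ketOf (d : Finset QDomain) (f : (QDomain → Fin 2) → ℂ) : Ket d :=
  WithLp.toLp 2 fun u => f (patch u 0)

theorem ketOf_res {d : Finset QDomain} {f : (QDomain → Fin 2) → ℂ} (hf : DependsOn f d)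
    (x : QDomain → Fin 2) : ketOf d f (res d x) = f x :=
  hf fun _ hi => patch_mem _ _ hi

/-- A heap acts on vectors as the corresponding combination of rank one operators. -/
theorem Rep.apply {d : Finset QDomain} {J : Type} [Fintype J] {ρ : Op d}
    {r : J → (QDomain → Fin 2) → ℂ} (hr : Rep ρ r) : ∃ c : ℂ, c ≠ 0 ∧ ∀ w : Ket d,
      Matrix.toEuclideanLin ρ w = c • ∑ j, inner ℂ (ketOf d (r j)) w • ketOf d (r j) := by
  obtain ⟨-, c, hc, hρ⟩ := hr
  refine ⟨c, hc, fun w => ?_⟩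
  ext u
  have h1 : ∀ v, ρ u v = c * ∑ j, ketOf d (r j) u * star (ketOf d (r j) v) := fun v => by
    have := hρ (patch u 0) (patch v 0)
    rwa [res_patch, res_patch] at this
  simp only [Matrix.toLpLin_apply, Matrix.mulVec, dotProduct, h1, PiLp.smul_apply,
    WithLp.ofLp_sum, Finset.sum_apply, WithLp.ofLp_smul, Pi.smul_apply, smul_eq_mul,
    PiLp.inner_apply, RCLike.inner_apply, Finset.mul_sum, Finset.sum_mul]
  rw [Finset.sum_comm]
  refine Finset.sum_congr rfl fun j _ => Finset.sum_congr rfl fun v _ => ?_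
  simp only [starRingEnd_apply]
  ring

theorem Rep.supp_le {d : Finset QDomain} {J : Type} [Fintype J] {ρ : Op d}
    {r : J → (QDomain → Fin 2) → ℂ} (hr : Rep ρ r) {B : Submodule ℂ (Ket d)}
    (hB : ∀ j, ketOf d (r j) ∈ B) : supp ρ ≤ B := by
  obtain ⟨c, -, hρ⟩ := hr.apply
  rw [← Submodule.orthogonal_orthogonal B]
  refine Submodule.orthogonal_le fun w hw => ?_
  rw [LinearMap.mem_ker, hρ]
  simp [fun j => Submodule.inner_right_of_mem_orthogonal (hB j) hw]

theorem Rep.mem_supp {d : Finset QDomain} {J : Type} [Fintype J] {ρ : Op d}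
    {r : J → (QDomain → Fin 2) → ℂ} (hr : Rep ρ r) (j : J) : ketOf d (r j) ∈ supp ρ := by
  obtain ⟨c, hc, hρ⟩ := hr.apply
  rw [supp, Submodule.mem_orthogonal]
  intro w hw
  rw [LinearMap.mem_ker, hρ, smul_eq_zero, or_iff_right hc] at hw
  have h1 := congrArg (inner ℂ w) hw
  rw [inner_zero_right, inner_sum] at h1
  have h2 : ∀ j, inner ℂ w (inner ℂ (ketOf d (r j)) w • ketOf d (r j)) =
      inner ℂ w (ketOf d (r j)) * star (inner ℂ w (ketOf d (r j))) := fun j => by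
    rw [inner_smul_right, ← inner_conj_symm (ketOf d (r j)) w, mul_comm]
    rfl
  simp only [h2] at h1
  have h3 := (Finset.sum_eq_zero_iff_of_nonneg fun j _ => mul_star_self_nonneg _).1 h1 j
    (Finset.mem_univ _)
  rcases mul_eq_zero.1 h3 with h | h
  · exact h
  · exact star_eq_zero.1 h

theorem supp_ne_bot {d : Finset QDomain} (ρ : Density d) : supp ρ.1 ≠ ⊥ := by
  intro h
  obtain ⟨r, hr⟩ := exists_rep ρ.2.1
  refine Density.ne_zero ρ (hr.eq_zero_of_forall fun j => funext fun x => ?_)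
  have h1 := hr.mem_supp j
  rw [h, Submodule.mem_bot] at h1
  rw [← ketOf_res (hr.1 j), h1]
  rfl

theorem nameDom_subset_of_sat {ρ : QHeap} {s : Finset QName}
    {P : Submodule ℂ (Ket (nameDom s))} (h : Sat ρ (Assr.contains s P)) : nameDom s ⊆ ρ.1 := by
  by_contra hs
  exact supp_ne_bot ρ.2 (le_bot_iff.1 (h.trans (Assr.contains_sem_le fun hs' => (hs hs').elim)))

/-! ### Bell states -/

/-- Sets the values of both `q` and `q'` to `b`. -/
def setBoth (q q' : QName) (b : Fin 2) (x : QDomain → Fin 2) : QDomain → Fin 2 :=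
  Function.update (Function.update x (Sum.inl q) b) (Sum.inl q') b

/-- The function `f` of labels is, up to a factor, the product of the Bell state of `q` and `q'`
with a function of the other coordinates. -/
def BellSymm (q q' : QName) (f : (QDomain → Fin 2) → ℂ) : Prop :=
  (∀ x, x (Sum.inl q) ≠ x (Sum.inl q') → f x = 0) ∧
    ∀ x b, f (setBoth q q' b x) = f (setBoth q q' 0 x)

/-- The vectors over `d` in which `q` and `q'` form a Bell state. -/
def bellSpace (q q' : QName) (d : Finset QDomain) : Submodule ℂ (Ket d) where
  carrier := {v | BellSymm q q' fun x => v (res d x)}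
  zero_mem' := ⟨fun _ _ => rfl, fun _ _ => rfl⟩
  add_mem' {v w} hv hw := ⟨fun x hx => by
    change v (res d x) + w (res d x) = 0
    rw [show v (res d x) = 0 from hv.1 x hx, show w (res d x) = 0 from hw.1 x hx, add_zero],
    fun x b => congrArg₂ (· + ·) (hv.2 x b) (hw.2 x b)⟩
  smul_mem' c v hv := ⟨fun x hx => by
    change c * v (res d x) = 0
    rw [show v (res d x) = 0 from hv.1 x hx, mul_zero], fun x b => congrArg (c * ·) (hv.2 x b)⟩

theorem mem_nameDom_pair {q q' : QName} {i : QDomain} :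
    i ∈ nameDom {q, q'} ↔ i = Sum.inl q ∨ i = Sum.inl q' := by
  simp [nameDom]

theorem bellAssr_sem_le (q q' : QName) (d : Finset QDomain) :
    (bellAssr q q').sem d ≤ bellSpace q q' d := by
  refine Assr.contains_sem_le fun hs v hv w => ?_
  obtain ⟨c, rfl⟩ := Submodule.mem_span_singleton.1 hv
  have h1 : ∀ x, tensorKet hs Finset.sdiff_subset (c • bellKet q q') w (res d x) =
      (c * if x (Sum.inl q) = x (Sum.inl q') then ((1 / √2 : ℝ) : ℂ) else 0) *
        w (res (d \ nameDom {q, q'}) x) := fun x => rfl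
  refine ⟨fun x hx => ?_, fun x b => ?_⟩
  · beta_reduce
    rw [h1, if_neg hx, mul_zero, zero_mul]
  · beta_reduce
    have h2 : ∀ b, res (d \ nameDom {q, q'}) (setBoth q q' b x) =
        res (d \ nameDom {q, q'}) x := by
      intro b
      funext i
      have := (Finset.mem_sdiff.1 i.2).2
      rw [mem_nameDom_pair, not_or] at this
      simp [res, setBoth, Function.update_of_ne this.1, Function.update_of_ne this.2]
    have h3 : ∀ b, setBoth q q' b x (Sum.inl q) = setBoth q q' b x (Sum.inl q') := by
      intro b
      by_cases hqq : (Sum.inl q : QDomain) = Sum.inl q' <;> simp [setBoth, hqq]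
    rw [h1, h1, h2, h2, if_pos (h3 b), if_pos (h3 0)]

theorem bellSpace_le {q q' : QName} {d : Finset QDomain} (hq : Sum.inl q ∈ d)
    (hq' : Sum.inl q' ∈ d) : bellSpace q q' d ≤ (bellAssr q q').sem d := by
  intro v hv
  have hs : nameDom {q, q'} ⊆ d := fun i hi => by
    rcases mem_nameDom_pair.1 hi with rfl | rfl <;> assumption
  have : v = tensorKet hs Finset.sdiff_subset (bellKet q q')
      (WithLp.toLp 2 fun z : ↥(d \ nameDom {q, q'}) → Fin 2 =>
        ((√2 : ℝ) : ℂ) * v (glue 0 z)) := by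
    ext u
    rw [← res_patch u 0]
    generalize patch u 0 = x
    have h1 : tensorKet hs Finset.sdiff_subset (bellKet q q')
      (WithLp.toLp 2 fun z : ↥(d \ nameDom {q, q'}) → Fin 2 =>
        ((√2 : ℝ) : ℂ) * v (glue 0 z)) (res d x) =
        (if x (Sum.inl q) = x (Sum.inl q') then ((1 / √2 : ℝ) : ℂ) else 0) *
          (((√2 : ℝ) : ℂ) * v (glue 0 (res (d \ nameDom {q, q'}) x))) := rfl
    rw [h1]
    split_ifs with hx
    · have h2 : x = setBoth q q' (x (Sum.inl q)) x := by
        rw [setBoth, Function.update_eq_self, hx, Function.update_eq_self]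
      have h3 : res d (setBoth q q' 0 x) = glue 0 (res (d \ nameDom {q, q'}) x) := by
        funext i
        unfold glue res setBoth
        split_ifs with hi
        · by_cases hi' : i.1 = Sum.inl q'
          · simp [hi']
          · have hiq := (mem_nameDom_pair.1 hi).resolve_right hi'
            rw [Function.update_of_ne hi']
            simp [hiq]
        · rw [mem_nameDom_pair, not_or] at hi
          rw [Function.update_of_ne hi.2, Function.update_of_ne hi.1]
      have h4 : v (res d (setBoth q q' (x (Sum.inl q)) x)) = v (res d (setBoth q q' 0 x)) :=
        hv.2 x (x (Sum.inl q))
      rw [← h2, h3] at h4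
      rw [h4, ← mul_assoc, ← Complex.ofReal_mul]
      simp
    · rw [zero_mul]
      exact hv.1 x hx
  rw [this]
  exact Assr.tensorKet_mem_contains hs (Submodule.mem_span_singleton_self _) _

theorem Rep.bellSymm {d : Finset QDomain} {J : Type} [Fintype J] {ρ : Op d}
    {r : J → (QDomain → Fin 2) → ℂ} (hr : Rep ρ r) {q q' : QName}
    (h : supp ρ ≤ (bellAssr q q').sem d) (j : J) : BellSymm q q' (r j) := by
  have h1 := bellAssr_sem_le q q' d (h (hr.mem_supp j))
  have h2 : (fun x => ketOf d (r j) (res d x)) = r j := funext fun x => ketOf_res (hr.1 j) x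
  rw [← h2]
  exact h1

theorem Covers.bellSymm {J : Type} {n : Finset QDomain} {r : J → (QDomain → Fin 2) → ℂ}
    {ξ : (QDomain → Fin 2) → ℂ} (h : Covers n r ξ) {q q' : QName} (hq : Sum.inl q ∈ n)
    (hq' : Sum.inl q' ∈ n) (hr : ∀ j, BellSymm q q' (r j)) : BellSymm q q' ξ := by
  refine ⟨fun x hx => ?_, fun x b => ?_⟩
  · have h1 := h.eq_of_eq 1 0 x x (fun j y => ?_) x
    · rwa [Finset.piecewise_same, one_mul, zero_mul] at h1
    · rw [(hr j).1, mul_zero, zero_mul]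
      rwa [Finset.piecewise_eq_of_mem _ _ _ hq, Finset.piecewise_eq_of_mem _ _ _ hq']
  · have hset : ∀ b y, n.piecewise (setBoth q q' b x) y = setBoth q q' b (n.piecewise x y) := by
      intro b y
      funext i
      simp only [Finset.piecewise, setBoth, Function.update_apply]
      grind
    have h1 := h.eq_of_eq 1 1 (setBoth q q' b x) (setBoth q q' 0 x) (fun j y => ?_) x
    · rwa [one_mul, one_mul, hset, hset, Finset.piecewise_same] at h1
    · rw [hset, hset, (hr j).2]

/-! ### Operators along a path -/

/-- The products, in order, of one operator for each step of a path: a Kraus operator for a basic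
operation, and an arbitrary operator outside the domains before or after the step for an allocation
or a deallocation. -/
inductive PathKraus (D : Finset QDomain) :
    Finset QDomain → List (PathOp × Finset QDomain) → Op D → Prop
  | nil (d : Finset QDomain) : PathKraus D d [] 1
  | grow {d d' : Finset QDomain} {o : PathOp} {π : List (PathOp × Finset QDomain)} {L : Op D}
      (h : d ⊂ d') (A : Op ↥(D \ d)) (hL : PathKraus D d' π L) :
      PathKraus D d ((o, d') :: π) (L * liftMat (incl Finset.sdiff_subset) A)
  | shrink {d d' : Finset QDomain} {o : PathOp} {π : List (PathOp × Finset QDomain)} {L : Op D}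
      (h : d' ⊂ d) (A : Op ↥(D \ d')) (hL : PathKraus D d' π L) :
      PathKraus D d ((o, d') :: π) (L * liftMat (incl Finset.sdiff_subset) A)
  | basic {d : Finset QDomain} {π : List (PathOp × Finset QDomain)} {L : Op D} {n : ℕ}
      {v : Fin n ↪ QName} {B : Type} [Fintype B] (K : B → Op (Fin n)) (b : B)
      (h : ∀ i, Sum.inl (v i) ∈ D) (hL : PathKraus D d π L) :
      PathKraus D d ((.basic v (∑ b, conjOp (K b)), d) :: π) (L * liftMat (place v h) (K b))

/-- The encodings of a path are quantum operations built from the operators along the path. -/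
theorem Encodes.mem_sandSpan {D : Finset QDomain} {S : Option Stmt} {d : Finset QDomain}
    {π : List (PathOp × Finset QDomain)} (hπ : IsPath S d π) {E : SuperOp D}
    (hE : Encodes D d π E) : E ∈ sandSpan {K | PathKraus D d π K} ∧ IsQuantumOp E := by
  induction hπ generalizing E with
  | nil d =>
    cases hE
    refine ⟨?_, isQuantumOp_id⟩
    have : (LinearMap.id : SuperOp D) = sand 1 1 := by
      ext1 A
      simp [sand]
    rw [this]
    exact sand_mem_sandSpan (.nil d) (.nil d)
  | @cons S S' d d' o π h _ ih =>
    cases hE with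
    | @cons _ _ _ _ F G hF hG =>
      obtain ⟨ihs, ihq⟩ := ih hG
      cases hF with
      | grow hd E hE =>
        exact ⟨comp_mem_sandSpan (T := {K | ∃ A, K = liftMat (incl Finset.sdiff_subset) A})
          (liftOp_mem_sandSpan (mem_sandSpan_univ E) fun A _ => ⟨A, rfl⟩) ihs
          (by rintro _ ⟨A, rfl⟩ L hL; exact .grow hd A hL), ihq.comp (hE.liftOp _)⟩
      | shrink hd E hE =>
        exact ⟨comp_mem_sandSpan (T := {K | ∃ A, K = liftMat (incl Finset.sdiff_subset) A})
          (liftOp_mem_sandSpan (mem_sandSpan_univ E) fun A _ => ⟨A, rfl⟩) ihs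
          (by rintro _ ⟨A, rfl⟩ L hL; exact .shrink hd A hL), ihq.comp (hE.liftOp _)⟩
      | basic hv =>
        obtain ⟨B, _, K, rfl, hE⟩ := h.head.1.isKraus
        refine ⟨comp_mem_sandSpan (T := {L | ∃ b, L = liftMat (place _ hv) (K b)}) ?_ ihs
          (by rintro _ ⟨b, rfl⟩ L hL; exact .basic K b hv hL), ihq.comp (hE.liftOp _)⟩
        rw [liftOp_sum]
        refine Submodule.sum_mem _ fun b _ => ?_
        rw [conjOp_eq_sand, liftOp_sand]
        exact sand_mem_sandSpan ⟨b, rfl⟩ ⟨b, rfl⟩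

/-- Operators on the qubits in `D` act for each value of a further qubit `p` separately. -/
theorem act_res {ι : Type} [Fintype ι] [DecidableEq ι] {D : Finset QDomain} (e : ι ↪ D)
    (K : Op ι) {p : QDomain} (hp : p ∉ D) (f : Fin 2 → (D → Fin 2) → ℂ) :
    act (e.trans (Function.Embedding.subtype _)) K (fun x => f (x p) (res D x)) =
      fun x => (liftMat e K).mulVec (f (x p)) (res D x) := by
  funext x
  rw [liftMat_mulVec]
  refine Finset.sum_congr rfl fun u _ => ?_
  congr 1
  have h1 : Function.extend (e.trans (Function.Embedding.subtype _)) u x p = x p := by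
    refine Function.extend_apply' _ _ _ ?_
    rintro ⟨a, rfl⟩
    exact hp (e a).2
  have h2 : res D (Function.extend (e.trans (Function.Embedding.subtype _)) u x) =
      Function.extend e u (res D x) := by
    funext i
    by_cases hi : ∃ a, e a = i
    · obtain ⟨a, rfl⟩ := hi
      rw [e.injective.extend_apply]
      exact (e.trans (Function.Embedding.subtype _)).injective.extend_apply u x a
    · rw [Function.extend_apply' _ _ _ hi]
      refine Function.extend_apply' _ _ _ ?_
      rintro ⟨a, ha⟩
      exact hi ⟨a, Subtype.ext ha⟩
  beta_reduce
  rw [h1, h2]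

theorem subset_alloc {d : Finset QDomain} {p : QName} {s : ℕ} (hs : Sum.inr s ∉ d) :
    d ⊆ insert (Sum.inl p) (renameDom p s d) := by
  intro i hi
  by_cases hip : i = Sum.inl p
  · simp [hip]
  · refine Finset.mem_insert_of_mem (mem_renameDom.2 ?_)
    rwa [Equiv.swap_apply_of_ne_of_ne hip fun h : i = Sum.inr s => hs (h ▸ hi)]

theorem subset_pathDom (d : Finset QDomain) (π : List (PathOp × Finset QDomain)) :
    d ⊆ pathDom d π := by
  cases π with
  | nil => exact subset_rfl
  | cons p π => exact Finset.subset_union_left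

/-- Operators along a path are realized by runs of the program.  The vectors in play are carried
by the qubits in `D` and one further qubit `q'` that the path does not touch: `f a` is the part in
which `q'` has the value `a`. -/
theorem exists_run {D : Finset QDomain} {q' : QName} (hq' : Sum.inl q' ∉ D) {S : Option Stmt}
    {d : Finset QDomain} {π : List (PathOp × Finset QDomain)} (hπ : IsPath S d π)
    (hD : pathDom d π ⊆ D) {K : Op D} (hK : PathKraus D d π K) (f : Fin 2 → (D → Fin 2) → ℂ)
    {ρ : QHeap} (hnm : nm ρ.1 = insert (Sum.inl q') (nm d)) {J : Type} [Fintype J]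
    {r : J → (QDomain → Fin 2) → ℂ} (hr : Rep ρ.2.1 r)
    (hc : Covers (nm ρ.1) r fun x => f (x (Sum.inl q')) (res D x)) :
    (∀ a, K.mulVec (f a) = 0) ∨
      ∃ ρ', Relation.ReflTransGen Step (S, ρ) (none, ρ') ∧
        ∃ (J' : Type) (_ : Fintype J') (r' : J' → (QDomain → Fin 2) → ℂ), Rep ρ'.2.1 r' ∧
          Covers (nm ρ'.1) r' fun x => K.mulVec (f (x (Sum.inl q'))) (res D x) := by
  induction hπ generalizing K f ρ J r with
  | nil d =>
    cases hK
    exact .inr ⟨ρ, .refl, J, inferInstance, r, hr, by simpa only [Matrix.one_mulVec] using hc⟩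
  | @cons S S' d d' o π h _ ih =>
    have hdD : d ⊆ D := Finset.subset_union_left.trans hD
    have hπD : pathDom d' π ⊆ D := Finset.subset_union_right.trans hD
    have hd'D : d' ⊆ D := (subset_pathDom _ _).trans hπD
    obtain ⟨hH, hdom⟩ := h.head
    obtain ⟨d₁, ρ⟩ := ρ
    -- it suffices to follow one step of the path
    have hstep : ∀ {M L : Op D}, PathKraus D d' π L →
        ((∀ a, M.mulVec (f a) = 0) ∨ ∃ ρ', Effect o ⟨d₁, ρ⟩ ρ' ∧
          nm ρ'.1 = insert (Sum.inl q') (nm d') ∧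
          ∃ (J' : Type) (_ : Fintype J') (r' : J' → (QDomain → Fin 2) → ℂ), Rep ρ'.2.1 r' ∧
          Covers (nm ρ'.1) r' fun x => M.mulVec (f (x (Sum.inl q'))) (res D x)) →
        (∀ a, (L * M).mulVec (f a) = 0) ∨
      ∃ ρ', Relation.ReflTransGen Step (some S, ⟨d₁, ρ⟩) (none, ρ') ∧
        ∃ (J' : Type) (_ : Fintype J') (r' : J' → (QDomain → Fin 2) → ℂ), Rep ρ'.2.1 r' ∧
          Covers (nm ρ'.1) r' fun x => (L * M).mulVec (f (x (Sum.inl q'))) (res D x) := by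
      intro M L hL hM
      simp only [← Matrix.mulVec_mulVec]
      rcases hM with hM | ⟨ρ', he, hnm', J', _, r', hr', hc'⟩
      · exact .inl fun a => by rw [hM, Matrix.mulVec_zero]
      · refine (ih hπD hL (fun a => M.mulVec (f a)) hnm' hr' hc').imp_right ?_
        rintro ⟨ρ'', hrun, h⟩
        exact ⟨ρ'', .head (hH.step he) hrun, h⟩
    cases hK with
    | grow hlt A hL =>
      refine hstep hL (.inr ?_)
      cases hdom with
      | basic => exact absurd hlt (ssubset_irrefl _)
      | free => exact absurd hlt (fun h => h.2 Finset.sdiff_subset)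
      | @alloc p _ s hs =>
        obtain ⟨s₁, hs₁⟩ := exists_fresh d₁
        obtain ⟨ρ', hρ', hr'⟩ := exists_alloc ρ hr p hs₁
        have hpq : p ≠ q' := by
          rintro rfl
          exact hq' (hd'D (Finset.mem_insert_self _ _))
        refine ⟨_, .alloc ρ s₁ hs₁ ρ' hρ', ?_, _, inferInstance, _, hr', ?_⟩
        · simp only [nm_alloc] at hnm ⊢
          rw [hnm]
          ext i
          have : (Sum.inl p : QDomain) ≠ Sum.inl q' := by simpa using hpq
          simp only [Finset.mem_insert, Finset.mem_sdiff, Finset.mem_singleton]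
          grind
        · rw [← act_res _ _ hq']
          simp only [nm_alloc] at hnm ⊢
          refine Covers.alloc (d := d₁) ?_ (by simp) hs₁
            (Finset.sdiff_subset.trans (nm_subset _)) (by simp) hr.1
          refine (hc.mono Finset.sdiff_subset).act_outside _ (fun i hi => ?_) _
          have hiD := Finset.mem_sdiff.1 i.2
          have hi' := (Finset.mem_sdiff.1 hi).1
          simp only [hnm] at hi'
          rcases Finset.mem_insert.1 hi' with h | h
          · exact hq' (h ▸ hiD.1)
          · exact hiD.2 (nm_subset _ h)
    | shrink hlt A hL =>
      refine hstep hL (.inr ?_)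
      cases hdom with
      | basic => exact absurd hlt (ssubset_irrefl _)
      | alloc s hs => exact absurd hlt (fun h => h.2 (subset_alloc hs))
      | @free p _ hp =>
        have hpq : p ≠ q' := by
          rintro rfl
          exact hq' (hdD hp)
        have hp₁ : Sum.inl p ∈ d₁ := by
          rw [← inl_mem_nm]
          simp only [hnm]
          exact Finset.mem_insert_of_mem (inl_mem_nm.2 hp)
        obtain ⟨ρ', hρ'⟩ := exists_free p ρ
        refine ⟨_, .free hp₁ ρ ρ' hρ', ?_, _, inferInstance, _, hρ' ▸ hr.free hp₁, ?_⟩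
        · simp only [nm_free] at hnm ⊢
          rw [hnm]
          ext i
          have : (Sum.inl p : QDomain) ≠ Sum.inl q' := by simpa using hpq
          simp only [Finset.mem_insert, Finset.mem_sdiff, Finset.mem_singleton]
          grind
        · rw [← act_res _ _ hq']
          simp only [nm_free] at hnm ⊢
          refine Covers.free ?_ (by simp)
          refine (hc.mono Finset.sdiff_subset).act_outside _ (fun i hi => ?_) _
          have hiD := Finset.mem_sdiff.1 i.2
          have hi' := Finset.mem_sdiff.1 hi
          simp only [hnm] at hi'
          rcases Finset.mem_insert.1 hi'.1 with h | h
          · exact hq' (h ▸ hiD.1)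
          · exact hiD.2 (Finset.mem_sdiff.2 ⟨nm_subset _ h, hi'.2⟩)
    | @basic _ _ _ n v B _ K b hv hL =>
      refine hstep hL ?_
      have hvd : ∀ i, Sum.inl (v i) ∈ d₁ := fun i => by
        rw [← inl_mem_nm]
        simp only [hnm]
        exact Finset.mem_insert_of_mem (inl_mem_nm.2 (hdom.need _ ⟨i, rfl⟩))
      have hE : IsQuantumOp (∑ b, conjOp (K b)) := by
        obtain ⟨_, _, _, -, hE⟩ := hH.isKraus
        exact hE
      have hc' := hc.act_inside (nameEmb v) (fun i => inl_mem_nm.2 (hvd i)) K b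
      have hemb : nameEmb v = (place v hv).trans (Function.Embedding.subtype _) := rfl
      have hact : act (nameEmb v) (K b) (fun x => f (x (Sum.inl q')) (res D x)) = _ :=
        act_res (place v hv) (K b) hq' f
      rw [hact] at hc'
      by_cases h0 : ∃ j : B × J, act (nameEmb v) (K j.1) (r j.2) ≠ 0
      · obtain ⟨j, hj⟩ := h0
        obtain ⟨ρ', he, hr'⟩ := Rep.exists_effect_basic hE hvd hr hj
        exact .inr ⟨_, he, hnm, _, inferInstance, _, hr', hc'⟩
      · push Not at h0
        refine .inl fun a => funext fun u => ?_
        have h1 := congrFun (hc'.eq_zero h0) (Function.update (patch u 0) (Sum.inl q') a)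
        have h2 : res D (Function.update (patch u 0) (Sum.inl q') a) = u := by
          funext i
          exact (Function.update_of_ne (fun h : i.1 = Sum.inl q' => hq' (h ▸ i.2)) _ _).trans
            (patch_mem _ _ i.2)
        simpa [h2] using h1

/-! ### Correct usage -/

theorem Stmt.qbit_finite (S : Stmt) : S.qbit.Finite := by
  induction S with
  | skip => exact Set.finite_empty
  | qalloc q => exact Set.finite_singleton q
  | qfree q => exact Set.finite_singleton q
  | init v => exact Set.finite_range v
  | unitary v U => exact Set.finite_range v
  | seq S₁ S₂ h₁ h₂ => exact h₁.union h₂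
  | ifm v M S h => exact (Set.finite_range v).union (Set.finite_iUnion h)
  | _ v M S h => exact (Set.finite_range v).union h

theorem Head.allocated {S : Stmt} {S' : Option Stmt} {o : PathOp} (h : Head S o S') :
    (∀ T, S' = some T → T.allocated ⊆ S.allocated) ∧ ∀ p, o = .alloc p → p ∈ S.allocated := by
  induction h with
  | seq_step _ ih =>
    refine ⟨?_, fun p hp => .inl (ih.2 p hp)⟩
    rintro _ ⟨⟩
    exact Set.union_subset_union_left _ (ih.1 _ rfl)
  | seq_done _ ih =>
    refine ⟨?_, fun p hp => .inl (ih.2 p hp)⟩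
    rintro _ ⟨⟩
    exact Set.subset_union_right
  | qalloc => exact ⟨nofun, fun p hp => by cases hp; rfl⟩
  | ifm m =>
    refine ⟨?_, nofun⟩
    rintro _ ⟨⟩
    exact Set.subset_iUnion (fun m => (Stmt.allocated _)) m
  | while_loop =>
    refine ⟨?_, nofun⟩
    rintro _ ⟨⟩
    exact Set.union_subset subset_rfl subset_rfl
  | _ => exact ⟨nofun, nofun⟩

/-- A qubit name that is never allocated does not enter the domain along a path. -/
theorem IsPath.notMem_pathDom {S : Option Stmt} {d : Finset QDomain}
    {π : List (PathOp × Finset QDomain)} (hπ : IsPath S d π) {q : QName}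
    (hS : ∀ T, S = some T → q ∉ T.allocated) (hq : Sum.inl q ∉ d) :
    Sum.inl q ∉ pathDom d π := by
  induction hπ with
  | nil d => exact hq
  | @cons S S' d d' o π h _ ih =>
    obtain ⟨hH, hdom⟩ := h.head
    refine Finset.notMem_union.2 ⟨hq, ih (fun T hT hqT => ?_) ?_⟩
    · exact hS _ rfl (hH.allocated.1 T hT hqT)
    · cases hdom with
      | basic => exact hq
      | free => exact fun h => hq (Finset.sdiff_subset h)
      | @alloc p _ s hs =>
        have hpq : q ≠ p := by
          rintro rfl
          exact hS _ rfl (hH.allocated.2 _ rfl)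
        rw [← inl_mem_nm, nm_alloc]
        simp [hpq, hq]

/-- Stability in `d` implies safety on every heap that contains the names in `d`. -/
theorem Stable.valid {S : Stmt} {d : Finset QDomain} (h : Stable S d) :
    Valid (Assr.contains d.toLeft ⊤) S Assr.top := by
  intro ρ hρ
  refine ⟨?_, fun _ _ => le_top⟩
  have hs : nm d ⊆ ρ.1 := nameDom_subset_of_sat hρ
  have hs' : nm d ⊆ nm ρ.1 := by
    rintro (a | s) hi
    · exact inl_mem_nm.2 (hs hi)
    · exact (inr_notMem_nm hi).elim
  obtain ⟨ρ₁, hρ₁⟩ := exists_dominates hs'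
  exact hρ₁.safe (h ρ₁)

/-- The Bell state of `q` and `q'` together with the basis states of the other qubits. -/
def bellFamily (q q' : QName) (d : Finset QDomain) (j : d → Fin 2) (x : QDomain → Fin 2) : ℂ :=
  if x (Sum.inl q) = x (Sum.inl q') ∧ ∀ i ∈ d, i ≠ Sum.inl q → x i = patch j 0 i then 1 else 0

theorem bellSymm_bellFamily {q q' : QName} {d : Finset QDomain} (hq' : Sum.inl q' ∉ d)
    (j : d → Fin 2) : BellSymm q q' (bellFamily q q' d j) := by
  refine ⟨fun x hx => if_neg fun h => hx h.1, fun x b => ?_⟩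
  unfold bellFamily
  congr 1
  simp only [setBoth, Function.update_apply]
  grind

theorem dependsOn_bellFamily {q q' : QName} {d : Finset QDomain} (hq : Sum.inl q ∈ d)
    (j : d → Fin 2) :
    DependsOn (bellFamily q q' d j) ((insert (Sum.inl q') d : Finset QDomain) : Set QDomain) := by
  intro x y hxy
  have h1 := hxy (Sum.inl q) (Finset.mem_insert_of_mem hq)
  have h2 := hxy (Sum.inl q') (Finset.mem_insert_self _ _)
  have h3 : (∀ i ∈ d, i ≠ Sum.inl q → x i = patch j 0 i) ↔
      ∀ i ∈ d, i ≠ Sum.inl q → y i = patch j 0 i :=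
    forall₂_congr fun i hi => by rw [hxy i (Finset.mem_insert_of_mem hi)]
  simp only [bellFamily, h1, h2, h3]

/-- A heap on `d` and `q'` in which `q` and `q'` form a Bell state and the other qubits are in the
completely mixed state. -/
theorem exists_bell_density {q q' : QName} {d : Finset QDomain} (hq : Sum.inl q ∈ d)
    (hq' : Sum.inl q' ∉ d) :
    ∃ ρ : Density (insert (Sum.inl q') d), Rep ρ.1 (bellFamily q q' d) ∧
      supp ρ.1 ≤ (bellAssr q q').sem (insert (Sum.inl q') d) := by
  have hne : bellFamily q q' d 0 ≠ 0 := by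
    intro h
    have h1 := congrFun h 0
    have h2 : ∀ i ∈ d, patch (0 : d → Fin 2) (0 : QDomain → Fin 2) i = 0 := fun i hi =>
      patch_mem _ _ hi
    rw [bellFamily, if_pos ⟨rfl, fun i hi _ => (h2 i hi).symm⟩] at h1
    exact one_ne_zero h1
  obtain ⟨ρ, hρ⟩ := exists_density (dependsOn_bellFamily hq) hne
  refine ⟨ρ, hρ, hρ.supp_le fun j => bellSpace_le (Finset.mem_insert_of_mem hq)
    (Finset.mem_insert_self _ _) ?_⟩
  have h2 : (fun x => ketOf (insert (Sum.inl q') d) (bellFamily q q' d j) (res _ x)) =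
    bellFamily q q' d j := funext fun x => ketOf_res (dependsOn_bellFamily hq j) x
  change BellSymm q q' _
  rw [h2]
  exact bellSymm_bellFamily hq' j

/-- The Bell state of `q` and `q'` together with an arbitrary basis state is covered. -/
theorem covers_bellFamily {q q' : QName} {d D : Finset QDomain} (hdD : d ⊆ D)
    (hq : Sum.inl q ∈ d) (hqD : Sum.inl q ∈ D) (hq'D : Sum.inl q' ∉ D) (y : D → Fin 2) :
    Covers (insert (Sum.inl q') d) (bellFamily q q' d) fun x =>
      (Pi.single (Function.update y ⟨Sum.inl q, hqD⟩ (x (Sum.inl q'))) 1 : (D → Fin 2) → ℂ)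
        (res D x) := by
  intro w _ hk x
  have hval : ∀ z : QDomain → Fin 2,
      (Pi.single (Function.update y ⟨Sum.inl q, hqD⟩ (z (Sum.inl q'))) 1 : (D → Fin 2) → ℂ)
        (res D z) = if z (Sum.inl q) = z (Sum.inl q') ∧
          ∀ i ∈ D, i ≠ Sum.inl q → z i = patch y 0 i then 1 else 0 := by
    intro z
    rw [Pi.single_apply]
    congr 1
    rw [eq_iff_iff, funext_iff]
    constructor
    · intro h
      refine ⟨by simpa [res] using h ⟨Sum.inl q, hqD⟩, fun i hi hiq => ?_⟩
      have h1 := h ⟨i, hi⟩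
      rw [Function.update_of_ne (by simpa using hiq)] at h1
      rw [patch_mem _ _ hi]
      exact h1
    · rintro ⟨h1, h2⟩ ⟨i, hi⟩
      by_cases hiq : i = Sum.inl q
      · subst hiq
        simpa [res] using h1
      · rw [Function.update_of_ne (by simpa using hiq)]
        have := h2 i hi hiq
        rwa [patch_mem _ _ hi] at this
  have hfac : ∀ z ∈ box (insert (Sum.inl q') d) x,
      (Pi.single (Function.update y ⟨Sum.inl q, hqD⟩ (z (Sum.inl q'))) 1 : (D → Fin 2) → ℂ)
        (res D z) = (if ∀ i ∈ D, i ∉ d → x i = patch y 0 i then 1 else 0) *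
          bellFamily q q' d (res d (patch y 0)) z := by
    intro z hz
    rw [hval, bellFamily, ite_mul, one_mul, zero_mul, ← ite_and]
    congr 1
    rw [eq_iff_iff]
    have hpatch : ∀ i ∈ d, patch (res d (patch y 0)) 0 i = patch y 0 i := fun i hi =>
      patch_mem _ _ hi
    have hz' : ∀ i ∈ D, i ∉ d → z i = x i := fun i hi hid =>
      mem_box.1 hz i (by
        rw [Finset.mem_insert, not_or]
        exact ⟨fun h => hq'D (h ▸ hi), hid⟩)
    constructor
    · rintro ⟨h1, h2⟩
      refine ⟨fun i hi hid => ?_, h1, fun i hi hiq => ?_⟩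
      · rw [← hz' i hi hid, h2 i hi fun h => hid (h ▸ hq)]
      · rw [hpatch i hi, h2 i (hdD hi) hiq]
    · rintro ⟨h1, h2, h3⟩
      refine ⟨h2, fun i hi hiq => ?_⟩
      by_cases hid : i ∈ d
      · rw [h3 i hid hiq, hpatch i hid]
      · rw [hz' i hi hid, h1 i hi hid]
  refine (Finset.sum_congr rfl fun z hz =>
    (congrArg (w z * ·) (hfac z hz)).trans (mul_left_comm _ _ _)).trans ?_
  rw [← Finset.mul_sum, hk _ x, mul_zero]

/-- A matrix whose columns preserve the Bell state of `q` and `q'` acts as the identity on `q`. -/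
theorem exists_eq_liftMat {q q' : QName} {D : Finset QDomain} (hqD : Sum.inl q ∈ D)
    (hq'D : Sum.inl q' ∉ D) {K : Op D}
    (hK : ∀ y : D → Fin 2, BellSymm q q' fun x =>
      K (res D x) (Function.update y ⟨Sum.inl q, hqD⟩ (x (Sum.inl q')))) :
    ∃ K' : Op ↥(D \ {Sum.inl q}), K = liftMat (incl Finset.sdiff_subset) K' := by
  classical
  set Q : D := ⟨Sum.inl q, hqD⟩ with hQ
  set e : ↥(D \ {Sum.inl q}) ↪ D := incl Finset.sdiff_subset with he
  have hqq' : (Sum.inl q : QDomain) ≠ Sum.inl q' := fun h => hq'D (h ▸ hqD)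
  have hrange : ∀ i : D, (¬∃ a, e a = i) ↔ i = Q := by
    intro i
    constructor
    · intro h
      by_contra hi
      exact h ⟨⟨i.1, Finset.mem_sdiff.2 ⟨i.2, fun h' =>
        hi (Subtype.ext (Finset.mem_singleton.1 h'))⟩⟩, rfl⟩
    · rintro rfl ⟨a, ha⟩
      have := (Finset.mem_sdiff.1 a.2).2
      exact this (Finset.mem_singleton.2 (congrArg Subtype.val ha))
  have hext : ∀ x : D → Fin 2, Function.extend e (x ∘ e) (0 : D → Fin 2) =
      Function.update x Q 0 := by
    intro x
    funext i
    by_cases hi : ∃ a, e a = i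
    · have hi' : i ≠ Q := fun h => (hrange i).2 h hi
      obtain ⟨a, rfl⟩ := hi
      rw [e.injective.extend_apply, Function.update_of_ne hi']
      rfl
    · rw [Function.extend_apply' _ _ _ hi, (hrange i).1 hi, Function.update_self]
      rfl
  refine ⟨Matrix.of fun u v => K (Function.extend e u 0) (Function.extend e v 0), ?_⟩
  ext x y
  simp only [liftMat, Matrix.of_apply, hrange, forall_eq, hext]
  have hres : ∀ b, res D (setBoth q q' b (patch x 0)) = Function.update x Q b := by
    intro b
    funext i
    have hi' : i.1 ≠ Sum.inl q' := fun h => hq'D (h ▸ i.2)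
    rw [res, setBoth, Function.update_of_ne hi']
    by_cases hi : i = Q
    · subst hi
      simp [hQ]
    · rw [Function.update_of_ne hi, Function.update_of_ne, patch_mem _ _ i.2]
      exact fun h => hi (Subtype.ext h)
  have hset : ∀ b, setBoth q q' b (patch x 0) (Sum.inl q') = b := fun b =>
    Function.update_self _ _ _
  split_ifs with hxy
  · have h1 := (hK y).2 (patch x 0) (x Q)
    simp only [hres, hset] at h1
    rw [Function.update_eq_self, ← hxy, Function.update_eq_self] at h1
    exact h1
  · have h1 := (hK y).1 (Function.update (patch x 0) (Sum.inl q') (y Q)) (by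
      rw [Function.update_of_ne hqq', Function.update_self, patch_mem _ _ hqD]
      exact fun h => hxy h.symm)
    have h2 : res D (Function.update (patch x 0) (Sum.inl q') (y Q)) = x := by
      funext i
      exact (Function.update_of_ne (fun h : i.1 = Sum.inl q' => hq'D (h ▸ i.2)) _ _).trans
        (patch_mem _ _ i.2)
    simpa only [h2, Function.update_self, Function.update_eq_self] using h1

end QSL

end

theorem mainTheorem3 (S : QSL.Stmt) (q : QSL.QName)
    (halloc : q ∉ S.allocated) (hfree : q ∉ S.freed)
    (htriple : ∀ (ψ : QSL.Assr) (q' : QSL.QName),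
      q' ≠ q → q' ∉ S.qbit → q' ∉ ψ.qbit →
      QSL.Valid ψ S QSL.Assr.top →
      QSL.Valid (QSL.Assr.and ψ (QSL.bellAssr q q')) S (QSL.bellAssr q q')) :
    QSL.CorrectlyUses S q := by
  open QSL in
  intro d π hstable hπ
  by_cases hqD : Sum.inl q ∈ pathDom d π
  swap
  · exact .inl hqD
  refine .inr fun E hE => ?_
  have hqd : Sum.inl q ∈ d := by
    by_contra h
    exact hπ.notMem_pathDom (fun T hT => by cases hT; exact halloc) h hqD
  obtain ⟨q', hq'⟩ := Infinite.exists_notMem_finset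
    (insert q (S.qbit_finite.toFinset ∪ (pathDom d π).toLeft))
  simp only [Finset.mem_insert, Finset.mem_union, Set.Finite.mem_toFinset, Finset.mem_toLeft,
    not_or] at hq'
  obtain ⟨hq'q, hq'S, hq'D⟩ := hq'
  have hdD : d ⊆ pathDom d π := subset_pathDom d π
  have hq'd : Sum.inl q' ∉ d := fun h => hq'D (hdD h)
  have hvalid := htriple (Assr.contains d.toLeft ⊤) q' hq'q hq'S
    (by simpa [Assr.contains, Assr.qbit] using hq'd) hstable.valid
  obtain ⟨ρ, hρ, hbell⟩ := exists_bell_density hqd hq'd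
  have hsat : Sat ⟨_, ρ⟩ (Assr.and (Assr.contains d.toLeft ⊤) (bellAssr q q')) := by
    refine le_inf ?_ hbell
    rw [Assr.contains_top_sem ((nm_subset d).trans (Finset.subset_insert _ _))]
    exact le_top
  obtain ⟨hspan, hquantum⟩ := Encodes.mem_sandSpan hπ hE
  suffices hK : ∀ K, PathKraus (pathDom d π) d π K → ∀ y : pathDom d π → Fin 2,
      BellSymm q q' fun x =>
        K (res _ x) (Function.update y ⟨Sum.inl q, hqD⟩ (x (Sum.inl q'))) by
    obtain ⟨E', rfl⟩ := exists_eq_liftOp (e := incl Finset.sdiff_subset) hspan fun K h =>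
      exists_eq_liftMat hqD hq'D (hK K h)
    exact ⟨E', isQuantumOp_of_liftOp hquantum, rfl⟩
  intro K hK y
  have hnm : nm (insert (Sum.inl q') d) = insert (Sum.inl q') (nm d) := by
    ext (a | s) <;> simp
  rcases exists_run (ρ := ⟨insert (Sum.inl q') d, ρ⟩) hq'D hπ subset_rfl hK
    (fun a => Pi.single (Function.update y ⟨Sum.inl q, hqD⟩ a) 1) hnm hρ
    ((covers_bellFamily hdD hqd hqD hq'D y).mono (nm_subset _)) with h0 | h
  · simp only [Matrix.mulVec_single_one] at h0
    have h1 : ∀ x a, K x (Function.update y ⟨Sum.inl q, hqD⟩ a) = 0 := fun x a =>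
      congrFun (h0 a) x
    exact ⟨fun x _ => h1 _ _, fun x b => by simp only [h1]⟩
  · obtain ⟨ρ', hrun, J', _, r', hr', hc'⟩ := h
    have hsat' := (hvalid _ hsat).2 ρ' hrun
    have hmem : ∀ p, p = q ∨ p = q' → Sum.inl p ∈ nm ρ'.1 := fun p hp =>
      inl_mem_nm.2 (nameDom_subset_of_sat hsat' (mem_nameDom_pair.2 (by simpa using hp)))
    have := hc'.bellSymm (hmem q (.inl rfl)) (hmem q' (.inr rfl)) (hr'.bellSymm hsat')
    simp only [Matrix.mulVec_single_one] at this
    exact this
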